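/- **Setting.** Consider a nonlinear system $\dot x=f(x,u)$, $y=C(t)x$ for $t\ge 0$, with $x(t)\in\mathbb R^n$, $u(t)\in\mathbb R^m$, $y(t)\in\mathbb R^p$, where $f$ is differentiable in $x$ and $C:[0,\infty)\to\mathbb R^{p\times n}$ is bounded. Norms are 2-norms and induced 2-norms, and $M_1\preceq M_2$ means that $M_2-M_1$ is symmetric positive semidefinite. Solutions of differential equations are continuous and satisfy the equation except possibly at finitely many times in each bounded interval. For a square matrix $M$ let $\operatorname{skew}(M)$ be the skew-symmetric matrix with entries $M_{ij}$ for $i>j$. The *extended subspace observer* with $k\le n$ columns is $$\dot{\hat x}=f(\hat x,u)+L(t)\,[\,y-C(t)\hat x\,],\qquad L=\bar Q P_1\bar C^{\top},\quad \bar C=C\bar Q,$$ $$\dot P_1=B_1P_1+P_1B_1^{\top}-P_1\bar C^{\top}\bar C P_1+G_1(t),\qquad P_1(t)\in\mathbb R^{k\times k},\quad P_1(0)\succ 0,$$ $$\dot{\bar Q}=(I_n-\bar Q\bar Q^{\top})A(t)\bar Q+\bar Q S_1,\qquad \bar Q(t)\in\mathbb R^{n\times k},\quad \bar Q(0)^{\top}\bar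 Q(0)=I_k,$$ with $A(t)=\frac{\partial f}{\partial x}(\hat x(t),u(t))$, $S_1=\operatorname{skew}(\bar Q^{\top}A\bar Q)$, $B_1=\bar Q^{\top}A\bar Q-S_1$, and $g_1I_k\preceq G_1(t)\preceq g_2I_k$ for constants $0<g_1\le g_2$. Fix a solution $x$ of the system and a solution $(\hat x,\bar Q,P_1)$ of the observer driven by $y=Cx$, both on $[0,\infty)$, such that $A$ is continuous except at finitely many times in each bounded interval. Let $Q(t)=[\bar Q(t)\ \ \bar Q_\perp(t)]\in\mathbb R^{n\times n}$ solve $\dot Q=Q\operatorname{skew}(Q^{\top}AQ)$ with $Q(0)$ orthogonal, let $q_i$ be the columns of $Q$, and let $$\beta_i^{\mathrm s}=\limsup_{t_0\to\infty,\ s\to\infty}\frac1s\int_{t_0}^{t_0+s}q_i(\tau)^{\top}A(\tau)q_i(\tau)\,d\tau$$ be the upper Bohl exponents. The number $k$ is chosen such that $j^\star\le k$, where $j^\star\in\{0,\dots,n\}$ is the smallest integer with $\beta^{\mathrm s}_i<0$ for all $i=j^\star+1,\dots,n$. Let $\eta(e,z,v)=f(z+e,v)-f(z,v)-\frac{\partial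 f}{\partial x}(z,v)\,e$. **Theorem (extended subspace observer).** Assume that - (a1) $A$ is bounded on $[0,\infty)$; - (a2) there are constants $p_1,p_2>0$ with $p_1I_k\preceq P_1(t)\preceq p_2I_k$ for all $t\ge 0$; - (a3) there are constants $\epsilon,\kappa>0$ with $\|\eta(e,z,v)\|\le\kappa\|e\|^2$ for all $z,e\in\mathbb R^n$, $v\in\mathbb R^m$ with $\|e\|\le\epsilon$. Then $e=x-\hat x$ is a solution of the estimation error dynamics $$\dot e=[A(t)-L(t)C(t)]\,e+\eta(e,\hat x(t),u(t)),$$ and this time-varying differential equation (with $\hat x,u,\bar Q,P_1$ the fixed functions of time above) is locally uniformly exponentially stable: $0$ is an equilibrium, and there are $\mu>0$, $\rho>0$, $K\ge1$ such that for all $0\le t_0\le T$ every solution $e$ on $[t_0,T]$ with $\|e(t_0)\|\le\rho$ satisfies $\|e(t)\|\le Ke^{-\mu(t-t_0)}\|e(t_0)\|$ for all $t\in[t_0,T]$. -/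

import Mathlib

open scoped Matrix Matrix.Norms.L2Operator

noncomputable section

/-- Euclidean space `ℝⁿ` (with the 2-norm). -/
abbrev Vec (n : ℕ) : Type := EuclideanSpace ℝ (Fin n)

/-- Real `n × k` matrices; their norm `‖M‖` is the one induced by the 2-norms. -/
abbrev Mat (n k : ℕ) : Type := Matrix (Fin n) (Fin k) ℝ

/-- The product `M v` of a matrix and a vector. -/
abbrev matVec {n k : ℕ} (M : Mat n k) (v : Vec k) : Vec n := Matrix.toEuclideanLin M v

/-- The order `M₁ ⪯ M₂`. With `M₁` symmetric it includes that `M₂` is symmetric. -/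
def LoewnerLE {k : ℕ} (M₁ M₂ : Mat k k) : Prop := (M₂ - M₁).PosSemidef

/-- `D` has finitely many points in every bounded interval `[0, T]`. -/
def LocallyFiniteTimes (D : Set ℝ) : Prop := ∀ T : ℝ, (D ∩ Set.Icc 0 T).Finite

/-- `A` is continuous on `[0, ∞)` except at a locally finite set of times. -/
def PiecewiseContinuous {n k : ℕ} (A : ℝ → Mat n k) : Prop :=
  ∃ D : Set ℝ, LocallyFiniteTimes D ∧
    ∀ t : ℝ, 0 ≤ t → t ∉ D → ContinuousWithinAt A (Set.Ici 0) t

/-- `ẋ = v` on the interval `I ⊆ [0, ∞)`, in the sense used for differential equations with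
piecewise continuous data: `x` is continuous, and `ẋ(t) = v(t)` (one-sided at the end points)
except at a locally finite set of times. A classical solution has no exceptional times. -/
def SolvesOn {E : Type} [NormedAddCommGroup E] [NormedSpace ℝ E] (I : Set ℝ)
    (x v : ℝ → E) : Prop :=
  ContinuousOn x I ∧ ∃ D : Set ℝ, LocallyFiniteTimes D ∧
    ∀ t ∈ I, t ∉ D → HasDerivWithinAt x (v t) I t

/-- `Ṁ = V` on `[0, ∞)` for matrix-valued curves, entry by entry. -/
def MatSolves {n k : ℕ} (M V : ℝ → Mat n k) : Prop :=
  ∀ i j, SolvesOn (Set.Ici 0) (fun t => M t i j) (fun t => V t i j)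

/-! ### Stability -/

/-- The origin is an equilibrium of `ė = F(t, e)`, `t ≥ 0`, and it is locally uniformly
exponentially stable: the constants do not depend on the initial time `t₀`. The estimate is
required of every solution on every interval `[t₀, T]`, hence of every solution on `[t₀, ∞)`. -/
def LocallyUniformlyExpStable {n : ℕ} (F : ℝ → Vec n → Vec n) : Prop :=
  (∀ t : ℝ, 0 ≤ t → F t 0 = 0) ∧
  ∃ μ : ℝ, 0 < μ ∧ ∃ ρ : ℝ, 0 < ρ ∧ ∃ K : ℝ, 1 ≤ K ∧
    ∀ t₀ T : ℝ, 0 ≤ t₀ → t₀ ≤ T → ∀ e : ℝ → Vec n,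
      SolvesOn (Set.Icc t₀ T) e (fun t => F t (e t)) →
      ‖e t₀‖ ≤ ρ →
      ∀ t ∈ Set.Icc t₀ T, ‖e t‖ ≤ K * Real.exp (-μ * (t - t₀)) * ‖e t₀‖

/-! ### Continuous QR decomposition and Bohl exponents -/

/-- The skew-symmetric matrix whose entries strictly below the diagonal are those of `M`. -/
def skewOfLower {k : ℕ} (M : Mat k k) : Mat k k :=
  Matrix.of fun i j => if j < i then M i j else if i < j then -M j i else 0

/-- `S = skew(Qᵀ A Q)`, i.e. `sᵢⱼ = qᵢᵀ A qⱼ` for `i > j` with `qᵢ` the columns of `Q`. -/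
def qrSkew {n k : ℕ} (A : Mat n n) (Q : Mat n k) : Mat k k := skewOfLower (Qᵀ * A * Q)

/-- `B = Qᵀ A Q - S`. -/
def qrB {n k : ℕ} (A : Mat n n) (Q : Mat n k) : Mat k k := Qᵀ * A * Q - qrSkew A Q

/-- `Q` is the orthogonal factor of a continuous QR decomposition of a fundamental solution of
`ẋ = A(t) x`: `Q(0)` is orthogonal and `Q̇ = Q S`. -/
structure IsFullQR {n : ℕ} (A Q : ℝ → Mat n n) : Prop where
  init : (Q 0)ᵀ * Q 0 = 1
  ode : MatSolves Q (fun t => Q t * qrSkew (A t) (Q t))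

/-- The upper Bohl exponent of `b`: the upper limit of the mean of `b` over `[t₀, t₀ + s]` as
`t₀ → ∞` and `s → ∞`. -/
def upperBohl (b : ℝ → ℝ) : ℝ :=
  Filter.limsup (fun q : ℝ × ℝ => (1 / q.2) * ∫ τ in q.1..(q.1 + q.2), b τ)
    (Filter.atTop ×ˢ Filter.atTop)

/-- The first integer `0 ≤ j ≤ n` such that the upper Bohl exponents of `qᵢᵀ A qᵢ` are negative
for `i = j + 1, …, n` (columns counted from `1`). -/
def jStar {n : ℕ} (A Q : ℝ → Mat n n) : ℕ :=
  sInf {j : ℕ | j ≤ n ∧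
    ∀ i : Fin n, j ≤ (i : ℕ) → upperBohl (fun t => ((Q t)ᵀ * A t * Q t) i i) < 0}

/-! ### The extended subspace observer -/

/-- The Jacobian matrix `∂f/∂x` at `(x, u)`. -/
def jacobian {n m : ℕ} (f : Vec n → Vec m → Vec n) (x : Vec n) (u : Vec m) : Mat n n :=
  Matrix.of fun i j => (fderiv ℝ (fun z => f z u) x (EuclideanSpace.single j 1)) i

/-- The Jacobian `A(t)` along the estimate `x̂` and the input `u`. -/
def jacobianAlong {n m : ℕ} (f : Vec n → Vec m → Vec n) (xhat : ℝ → Vec n) (u : ℝ → Vec m)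
    (t : ℝ) : Mat n n :=
  jacobian f (xhat t) (u t)

/-- The remainder `η(e, x, u)` of the Taylor series of `f` at `x`, truncated after the linear
term. -/
def taylorRemainder {n m : ℕ} (f : Vec n → Vec m → Vec n) (e x : Vec n) (u : Vec m) : Vec n :=
  f (x + e) u - f x u - matVec (jacobian f x u) e

/-- The gain `L = Q̄ P₁ C̄ᵀ` with `C̄ = C Q̄`. -/
def observerGain {n k p : ℕ} (C : Mat p n) (Qbar : Mat n k) (P₁ : Mat k k) : Mat n p :=
  Qbar * P₁ * (C * Qbar)ᵀ

/-- `x` is a trajectory of the plant `ẋ = f(x, u)` on `[0, ∞)`. -/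
def IsPlantTrajectory {n m : ℕ} (f : Vec n → Vec m → Vec n) (u : ℝ → Vec m)
    (x : ℝ → Vec n) : Prop :=
  SolvesOn (Set.Ici 0) x (fun t => f (x t) (u t))

/-- `(x̂, Q̄, P₁)` is a trajectory on `[0, ∞)` of the extended subspace observer with weight `G₁`,
for the input `u` and the measured output `y`. -/
structure IsExtendedSubspaceObserver {n m p k : ℕ} (f : Vec n → Vec m → Vec n)
    (C : ℝ → Mat p n) (u : ℝ → Vec m) (y : ℝ → Vec p) (G₁ : ℝ → Mat k k)
    (xhat : ℝ → Vec n) (Qbar : ℝ → Mat n k) (P₁ : ℝ → Mat k k) : Prop where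
  /-- `g₁ I ⪯ G₁(t) ⪯ g₂ I` -/
  weight : ∃ g₁ g₂ : ℝ, 0 < g₁ ∧ g₁ ≤ g₂ ∧ ∀ t : ℝ, 0 ≤ t →
    LoewnerLE (g₁ • (1 : Mat k k)) (G₁ t) ∧ LoewnerLE (G₁ t) (g₂ • (1 : Mat k k))
  /-- `d/dt x̂ = f(x̂, u) + L (y - C x̂)` -/
  estimate : SolvesOn (Set.Ici 0) xhat (fun t =>
    f (xhat t) (u t) +
      matVec (observerGain (C t) (Qbar t) (P₁ t)) (y t - matVec (C t) (xhat t)))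
  /-- `Ṗ₁ = B₁ P₁ + P₁ B₁ᵀ - P₁ C̄ᵀ C̄ P₁ + G₁` -/
  riccati : MatSolves P₁ (fun t =>
    qrB (jacobianAlong f xhat u t) (Qbar t) * P₁ t +
      P₁ t * (qrB (jacobianAlong f xhat u t) (Qbar t))ᵀ -
      P₁ t * (C t * Qbar t)ᵀ * (C t * Qbar t) * P₁ t + G₁ t)
  riccati_init : (P₁ 0).PosDef
  /-- `d/dt Q̄ = (I - Q̄ Q̄ᵀ) A Q̄ + Q̄ S₁` -/
  qr : MatSolves Qbar (fun t =>
    (1 - Qbar t * (Qbar t)ᵀ) * jacobianAlong f xhat u t * Qbar t +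
      Qbar t * qrSkew (jacobianAlong f xhat u t) (Qbar t))
  qr_init : (Qbar 0)ᵀ * Qbar 0 = 1

/-- The right-hand side `(A(t) - L(t) C(t)) e + η(e, x̂(t), u(t))` of the error dynamics. -/
def errorField {n m p k : ℕ} (f : Vec n → Vec m → Vec n) (C : ℝ → Mat p n) (u : ℝ → Vec m)
    (xhat : ℝ → Vec n) (Qbar : ℝ → Mat n k) (P₁ : ℝ → Mat k k) (t : ℝ) (e : Vec n) : Vec n :=
  matVec (jacobianAlong f xhat u t - observerGain (C t) (Qbar t) (P₁ t) * C t) e +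
    taylorRemainder f e (xhat t) (u t)

end

/-!
The linearized error dynamics `ė = (A - L C) e` carries a quadratic Lyapunov function. In the
coordinates `z = Qᵀ e` it becomes block upper triangular: the gain `L = Q̄ P₁ C̄ᵀ` only enters the
first `k` rows, and `Qᵀ A Q - S` is upper triangular. The first diagonal block `B₁ - P₁ C̄ᵀ C̄` has
the Lyapunov matrix `P₁⁻¹` by the Riccati equation. The second one is upper triangular with
diagonal entries `b` of negative upper Bohl exponent; then `∫ b ≤ -1` over every window of some
fixed length `σ`, and integrating the squared solutions of `ẋ = b x` over such windows gives a
Lyapunov weight. A large weight on the driving subsystem absorbs the bounded coupling between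
blocks, and Lyapunov's indirect method absorbs the quadratic remainder `η`.
-/

open Set Filter Topology MeasureTheory Asymptotics

/-! ### Locally finite sets of times and differential inequalities -/

lemma LocallyFiniteTimes.union {D₁ D₂ : Set ℝ} (h₁ : LocallyFiniteTimes D₁)
    (h₂ : LocallyFiniteTimes D₂) : LocallyFiniteTimes (D₁ ∪ D₂) := fun T => by
  rw [union_inter_distrib_right]
  exact (h₁ T).union (h₂ T)

lemma LocallyFiniteTimes.iUnion {ι : Type*} [Finite ι] {D : ι → Set ℝ}
    (h : ∀ i, LocallyFiniteTimes (D i)) : LocallyFiniteTimes (⋃ i, D i) := fun T => by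
  rw [iUnion_inter]
  exact finite_iUnion fun i => h i T

lemma LocallyFiniteTimes.of_finite {D : Set ℝ} (h : D.Finite) : LocallyFiniteTimes D :=
  fun _ => h.inter_of_left _

lemma le_of_hasDerivAt_nonpos_off_finite {D : Set ℝ} (hD : D.Finite) {g : ℝ → ℝ} :
    ∀ {a b : ℝ}, a ≤ b → ContinuousOn g (Icc a b) →
      (∀ t ∈ Ioo a b, t ∉ D → ∃ g' ≤ 0, HasDerivAt g g' t) → g b ≤ g a := by
  induction D, hD using Set.Finite.induction_on with
  | empty =>
    intro a b hab hg hg'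
    choose! g' hle hder using fun t ht => hg' t ht (notMem_empty t)
    refine antitoneOn_of_hasDerivWithinAt_nonpos (f' := g') (convex_Icc a b) hg ?_ ?_
      (left_mem_Icc.2 hab) (right_mem_Icc.2 hab) hab
    · rw [interior_Icc]
      exact fun t ht => (hder t ht).hasDerivWithinAt
    · rwa [interior_Icc]
  | @insert c D _ _ ih =>
    intro a b hab hg hg'
    by_cases hc : c ∈ Ioo a b
    · calc g b ≤ g c := ih hc.2.le (hg.mono (Icc_subset_Icc_left hc.1.le)) fun t ht htD =>
            hg' t ⟨hc.1.trans ht.1, ht.2⟩ (by simp [ht.1.ne', htD])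
        _ ≤ g a := ih hc.1.le (hg.mono (Icc_subset_Icc_right hc.2.le)) fun t ht htD =>
            hg' t ⟨ht.1, ht.2.trans hc.2⟩ (by simp [ht.2.ne, htD])
    · exact ih hab hg fun t ht htD => hg' t ht (by rintro (rfl | h); exacts [hc ht, htD h])

lemma le_exp_mul_of_hasDerivAt_le_mul {D : Set ℝ} (hD : LocallyFiniteTimes D) {v : ℝ → ℝ}
    {a b c : ℝ} (ha : 0 ≤ a) (hab : a ≤ b) (hv : ContinuousOn v (Icc a b))
    (hv' : ∀ t ∈ Ioo a b, t ∉ D → ∃ v' ≤ c * v t, HasDerivAt v v' t) :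
    v b ≤ Real.exp (c * (b - a)) * v a := by
  have hexp (t : ℝ) : HasDerivAt (fun s => Real.exp (-c * (s - a)))
      (Real.exp (-c * (t - a)) * -c) t := by
    simpa using (((hasDerivAt_id t).sub_const a).const_mul (-c)).exp
  have hmono : Real.exp (-c * (b - a)) * v b ≤ Real.exp (-c * (a - a)) * v a := by
    refine le_of_hasDerivAt_nonpos_off_finite (g := fun s => Real.exp (-c * (s - a)) * v s)
      (hD b) hab (by fun_prop) fun t ht htD => ?_
    obtain ⟨v', hle, hder⟩ := hv' t ht fun h => htD ⟨h, ha.trans ht.1.le, ht.2.le⟩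
    refine ⟨_, ?_, (hexp t).mul hder⟩
    nlinarith [Real.exp_pos (-c * (t - a))]
  calc v b = Real.exp (c * (b - a)) * (Real.exp (-c * (b - a)) * v b) := by
        rw [← mul_assoc, ← Real.exp_add]; simp
    _ ≤ Real.exp (c * (b - a)) * v a := by
        gcongr
        simpa using hmono

lemma forall_lt_of_forall_Ico_lt {a b r : ℝ} {g : ℝ → ℝ} (hg : ContinuousOn g (Icc a b))
    (hstep : ∀ t ∈ Icc a b, (∀ s ∈ Ico a t, g s < r) → g t < r) :
    ∀ t ∈ Icc a b, g t < r := by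
  by_contra! hex
  obtain ⟨t', ht', hr⟩ := hex
  have hcompact : IsCompact (Icc a b ∩ g ⁻¹' Ici r) :=
    isCompact_Icc.of_isClosed_subset
      (hg.preimage_isClosed_of_isClosed isClosed_Icc isClosed_Ici) inter_subset_left
  obtain ⟨t, ⟨ht, hrt⟩, hleast⟩ := hcompact.exists_isLeast ⟨t', ht', hr⟩
  refine (hstep t ht fun s hs => ?_).not_ge hrt
  by_contra! hrs
  exact hs.2.not_ge (hleast ⟨⟨hs.1, hs.2.le.trans ht.2⟩, hrs⟩)

lemma norm_le_sqrt_mul_exp_mul_norm {E : Type*} [NormedAddCommGroup E] {x y : E} {m M c s : ℝ}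
    (hm : 0 < m) (hM : 0 ≤ M) (h : m * ‖x‖ ^ 2 ≤ Real.exp (-c * s) * (M * ‖y‖ ^ 2)) :
    ‖x‖ ≤ √(M / m) * Real.exp (-(c / 2) * s) * ‖y‖ := by
  refine (sq_le_sq₀ (norm_nonneg x) (by positivity)).1 ?_
  have hexp : Real.exp (-(c / 2) * s) ^ 2 = Real.exp (-c * s) := by
    rw [← Real.exp_nat_mul]; congr 1; push_cast; ring
  rw [mul_pow, mul_pow, hexp, Real.sq_sqrt (by positivity)]
  calc ‖x‖ ^ 2 ≤ Real.exp (-c * s) * (M * ‖y‖ ^ 2) / m := (le_div_iff₀' hm).2 h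
    _ = M / m * Real.exp (-c * s) * ‖y‖ ^ 2 := by ring

theorem locallyUniformlyExpStable_of_lyapunov {n : ℕ} {F : ℝ → Vec n → Vec n}
    (hF : ∀ t, 0 ≤ t → F t 0 = 0) {V : ℝ → Vec n → ℝ} {m M c r : ℝ} (hm : 0 < m) (hmM : m ≤ M)
    (hc : 0 < c) (hr : 0 < r) (hlow : ∀ t, 0 ≤ t → ∀ e, m * ‖e‖ ^ 2 ≤ V t e)
    (hupp : ∀ t, 0 ≤ t → ∀ e, V t e ≤ M * ‖e‖ ^ 2)
    (hdecay : ∀ t₀ T : ℝ, 0 ≤ t₀ → ∀ e : ℝ → Vec n,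
      SolvesOn (Icc t₀ T) e (fun t => F t (e t)) →
      ContinuousOn (fun t => V t (e t)) (Icc t₀ T) ∧ ∃ D, LocallyFiniteTimes D ∧
        ∀ t ∈ Ioo t₀ T, t ∉ D → ‖e t‖ < r →
          ∃ v' ≤ -c * V t (e t), HasDerivAt (fun s => V s (e s)) v' t) :
    LocallyUniformlyExpStable F := by
  have hM : 0 < M := hm.trans_le hmM
  set K := √(M / m)
  have hK : 1 ≤ K := Real.one_le_sqrt.2 ((one_le_div hm).2 hmM)
  refine ⟨hF, c / 2, half_pos hc, r / (2 * K), by positivity, K, hK, fun t₀ T ht₀ _ e he hini => ?_⟩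
  obtain ⟨hcont, D, hD, hder⟩ := hdecay t₀ T ht₀ e he
  have hest : ∀ t ∈ Icc t₀ T, (∀ s ∈ Ico t₀ t, ‖e s‖ < r) →
      ‖e t‖ ≤ K * Real.exp (-(c / 2) * (t - t₀)) * ‖e t₀‖ := fun t ht hsmall => by
    have hV := le_exp_mul_of_hasDerivAt_le_mul hD ht₀ ht.1
      (hcont.mono (Icc_subset_Icc_right ht.2)) fun s hs hsD =>
        hder s ⟨hs.1, hs.2.trans_le ht.2⟩ hsD (hsmall s (Ioo_subset_Ico_self hs))
    refine norm_le_sqrt_mul_exp_mul_norm hm hM.le ((hlow t (ht₀.trans ht.1) _).trans (hV.trans ?_))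
    gcongr
    exact hupp t₀ ht₀ _
  have hsmall : ∀ t ∈ Icc t₀ T, ‖e t‖ < r :=
    forall_lt_of_forall_Ico_lt he.1.norm fun t ht hs => by
      have hexp : Real.exp (-(c / 2) * (t - t₀)) ≤ 1 :=
        Real.exp_le_one_iff.2 (mul_nonpos_of_nonpos_of_nonneg (by linarith) (by linarith [ht.1]))
      calc ‖e t‖ ≤ K * 1 * (r / (2 * K)) := (hest t ht hs).trans (by gcongr)
        _ = r / 2 := by field_simp
        _ < r := half_lt_self hr
  exact fun t ht => hest t ht fun s hs => hsmall s ⟨hs.1, hs.2.le.trans ht.2⟩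

/-! ### Matrix-valued functions of time -/

section MatrixFunctions

variable {ι κ μ : Type*}

/-- Boundedness on `[0, ∞)` of a matrix-valued function of time, entry by entry so that it passes
to blocks. -/
def BoundedEntries (M : ℝ → Matrix ι κ ℝ) : Prop :=
  ∀ i j, (fun t => M t i j) =O[𝓟 (Ici 0)] fun _ => (1 : ℝ)

lemma BoundedEntries.of_norm_le [Fintype ι] [Fintype κ] [DecidableEq κ] {M : ℝ → Matrix ι κ ℝ}
    {c : ℝ} (h : ∀ t, 0 ≤ t → ‖M t‖ ≤ c) : BoundedEntries M := fun i j =>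
  isBigO_principal.2 ⟨c, fun t ht => by
    have hcol := (PiLp.norm_apply_le _ i).trans
      (Matrix.l2_opNorm_mulVec (M t) (EuclideanSpace.single j 1))
    simpa using hcol.trans (by simpa using h t ht)⟩

lemma BoundedEntries.transpose {M : ℝ → Matrix ι κ ℝ} (hM : BoundedEntries M) :
    BoundedEntries fun t => (M t)ᵀ :=
  fun i j => hM j i

lemma BoundedEntries.sub {M N : ℝ → Matrix ι κ ℝ} (hM : BoundedEntries M)
    (hN : BoundedEntries N) : BoundedEntries fun t => M t - N t :=
  fun i j => (hM i j).sub (hN i j)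

lemma BoundedEntries.mul [Fintype κ] {M : ℝ → Matrix ι κ ℝ} {N : ℝ → Matrix κ μ ℝ}
    (hM : BoundedEntries M) (hN : BoundedEntries N) : BoundedEntries fun t => M t * N t :=
  fun i j => by
    simpa only [Matrix.mul_apply, Finset.sum_fn, Pi.mul_apply, mul_one] using
      IsBigO.sum fun l (_ : l ∈ Finset.univ) => (hM i l).mul (hN l j)

lemma dotProduct_self_nonneg [Fintype ι] (v : ι → ℝ) : 0 ≤ v ⬝ᵥ v :=
  Finset.sum_nonneg fun i _ => mul_self_nonneg (v i)

lemma BoundedEntries.exists_mulVec_dotProduct_self_le [Fintype ι] [Fintype κ]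
    {M : ℝ → Matrix ι κ ℝ} (hM : BoundedEntries M) :
    ∃ c > 0, ∀ t, 0 ≤ t → ∀ y, (M t *ᵥ y) ⬝ᵥ (M t *ᵥ y) ≤ c * (y ⬝ᵥ y) := by
  have hsum : (fun t => ∑ i, ∑ j, M t i j ^ 2) =O[𝓟 (Ici 0)] fun _ => (1 : ℝ) := by
    refine IsBigO.fun_sum fun i _ => IsBigO.fun_sum fun j _ => ?_
    simpa using (hM i j).pow 2
  obtain ⟨c, hc, hle⟩ := hsum.exists_pos
  refine ⟨c, hc, fun t ht y => ?_⟩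
  calc (M t *ᵥ y) ⬝ᵥ (M t *ᵥ y) = ∑ i, (∑ j, M t i j * y j) ^ 2 := by
        simp only [dotProduct, Matrix.mulVec, sq]
    _ ≤ ∑ i, (∑ j, M t i j ^ 2) * ∑ j, y j ^ 2 :=
        Finset.sum_le_sum fun i _ => Finset.sum_mul_sq_le_sq_mul_sq _ _ _
    _ = (∑ i, ∑ j, M t i j ^ 2) * (y ⬝ᵥ y) := by
        simp only [← Finset.sum_mul, dotProduct, sq]
    _ ≤ c * (y ⬝ᵥ y) := by
        gcongr
        · exact dotProduct_self_nonneg y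
        · simpa using (le_abs_self _).trans (isBigOWith_principal.1 hle t ht)

lemma BoundedEntries.of_mulVec_dotProduct_self_le [Fintype ι] [Fintype κ]
    {M : ℝ → Matrix ι κ ℝ} {c : ℝ}
    (h : ∀ t, 0 ≤ t → ∀ v, (M t *ᵥ v) ⬝ᵥ (M t *ᵥ v) ≤ c * (v ⬝ᵥ v)) : BoundedEntries M :=
  fun i j => isBigO_principal.2 ⟨√c, fun t ht => by
    classical
    have hcol := h t ht (Pi.single j 1)
    have hentry : M t i j * M t i j ≤ ∑ l, M t l j * M t l j :=
      Finset.single_le_sum (fun l _ => mul_self_nonneg (M t l j)) (Finset.mem_univ i)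
    simp only [Matrix.mulVec_single_one, single_dotProduct, Pi.single_eq_same, mul_one] at hcol
    rw [norm_one, mul_one, Real.norm_eq_abs]
    exact Real.abs_le_sqrt (by simpa only [sq] using hentry.trans hcol)⟩

lemma two_mul_dotProduct_le [Fintype ι] {ε : ℝ} (hε : 0 < ε) (x z : ι → ℝ) :
    2 * (x ⬝ᵥ z) ≤ ε * (x ⬝ᵥ x) + ε⁻¹ * (z ⬝ᵥ z) := by
  simp only [dotProduct, Finset.mul_sum, ← Finset.sum_add_distrib]
  refine Finset.sum_le_sum fun i _ => ?_
  have hsq : ε * (x i * x i) + ε⁻¹ * (z i * z i) - 2 * (x i * z i) = ε * (x i - ε⁻¹ * z i) ^ 2 := by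
    field_simp
    ring
  linarith [mul_nonneg hε.le (sq_nonneg (x i - ε⁻¹ * z i))]

lemma BoundedEntries.of_transpose_mul_self_eq_one [Fintype ι] [DecidableEq κ]
    {W : ℝ → Matrix ι κ ℝ} (hW : ∀ t, 0 ≤ t → (W t)ᵀ * W t = 1) : BoundedEntries W := fun i j =>
  isBigO_principal.2 ⟨1, fun t ht => by
    have hcol : ∑ l, W t l j * W t l j = 1 := by
      simpa only [Matrix.mul_apply, Matrix.transpose_apply, Matrix.one_apply_eq] using
        congr_fun₂ (hW t ht) j j
    have hentry : W t i j * W t i j ≤ ∑ l, W t l j * W t l j :=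
      Finset.single_le_sum (fun l _ => mul_self_nonneg (W t l j)) (Finset.mem_univ i)
    simpa [← abs_le_one_iff_mul_self_le_one] using hentry.trans hcol.le⟩

lemma BoundedEntries.exists_two_mul_dotProduct_mulVec_le [Fintype ι] [Fintype κ]
    {M : ℝ → Matrix ι κ ℝ} (hM : BoundedEntries M) {ε : ℝ} (hε : 0 < ε) :
    ∃ c > 0, ∀ t, 0 ≤ t → ∀ x y,
      2 * (x ⬝ᵥ (M t *ᵥ y)) ≤ ε * (x ⬝ᵥ x) + c * (y ⬝ᵥ y) := by
  obtain ⟨c, hc, hle⟩ := hM.exists_mulVec_dotProduct_self_le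
  refine ⟨ε⁻¹ * c, by positivity, fun t ht x y => (two_mul_dotProduct_le hε x _).trans ?_⟩
  rw [mul_assoc]
  gcongr
  exact hle t ht y

lemma hasDerivWithinAt_matrix [Finite ι] [Finite κ] {M : ℝ → Matrix ι κ ℝ} {M' : Matrix ι κ ℝ}
    {s : Set ℝ} {t : ℝ} :
    HasDerivWithinAt M M' s t ↔ ∀ i j, HasDerivWithinAt (fun τ => M τ i j) (M' i j) s t := by
  cases nonempty_fintype ι
  cases nonempty_fintype κ
  exact hasDerivWithinAt_pi.trans (forall_congr' fun _ => hasDerivWithinAt_pi)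

lemma continuousOn_matrix {M : ℝ → Matrix ι κ ℝ} {s : Set ℝ} :
    ContinuousOn M s ↔ ∀ i j, ContinuousOn (fun τ => M τ i j) s :=
  continuousOn_pi.trans (forall_congr' fun _ => continuousOn_pi)

lemma hasDerivWithinAt_transpose [Finite ι] [Finite κ] {M : ℝ → Matrix ι κ ℝ} {M' : Matrix ι κ ℝ}
    {s : Set ℝ} {t : ℝ} (hM : HasDerivWithinAt M M' s t) :
    HasDerivWithinAt (fun τ => (M τ)ᵀ) M'ᵀ s t :=
  hasDerivWithinAt_matrix.2 fun i j => hasDerivWithinAt_matrix.1 hM j i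

lemma hasDerivWithinAt_dotProduct [Fintype ι] {x y : ℝ → ι → ℝ} {x' y' : ι → ℝ} {s : Set ℝ}
    {t : ℝ} (hx : HasDerivWithinAt x x' s t) (hy : HasDerivWithinAt y y' s t) :
    HasDerivWithinAt (fun τ => x τ ⬝ᵥ y τ) (x' ⬝ᵥ y t + x t ⬝ᵥ y') s t := by
  simp only [dotProduct, ← Finset.sum_add_distrib]
  exact HasDerivWithinAt.fun_sum fun i _ =>
    (hasDerivWithinAt_pi.1 hx i).mul (hasDerivWithinAt_pi.1 hy i)

lemma hasDerivWithinAt_mulVec [Finite ι] [Fintype κ] {M : ℝ → Matrix ι κ ℝ} {M' : Matrix ι κ ℝ}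
    {x : ℝ → κ → ℝ} {x' : κ → ℝ} {s : Set ℝ} {t : ℝ} (hM : HasDerivWithinAt M M' s t)
    (hx : HasDerivWithinAt x x' s t) :
    HasDerivWithinAt (fun τ => M τ *ᵥ x τ) (M' *ᵥ x t + M t *ᵥ x') s t := by
  cases nonempty_fintype ι
  exact hasDerivWithinAt_pi.2 fun i =>
    hasDerivWithinAt_dotProduct (hasDerivWithinAt_pi.2 (hasDerivWithinAt_matrix.1 hM i)) hx

lemma hasDerivWithinAt_matrix_mul [Finite ι] [Fintype κ] [Finite μ] {M : ℝ → Matrix ι κ ℝ}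
    {N : ℝ → Matrix κ μ ℝ} {M' : Matrix ι κ ℝ} {N' : Matrix κ μ ℝ} {s : Set ℝ} {t : ℝ}
    (hM : HasDerivWithinAt M M' s t) (hN : HasDerivWithinAt N N' s t) :
    HasDerivWithinAt (fun τ => M τ * N τ) (M' * N t + M t * N') s t :=
  hasDerivWithinAt_matrix.2 fun i j =>
    hasDerivWithinAt_dotProduct (hasDerivWithinAt_pi.2 (hasDerivWithinAt_matrix.1 hM i))
      (hasDerivWithinAt_pi.2 fun l => hasDerivWithinAt_matrix.1 hN l j)

lemma hasDerivWithinAt_quadraticForm [Fintype ι] {Λ : ℝ → Matrix ι ι ℝ}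
    {Λ' A : Matrix ι ι ℝ} {x : ℝ → ι → ℝ} {h : ι → ℝ} {s : Set ℝ} {t : ℝ}
    (hsymm : (Λ t).IsSymm) (hΛ : HasDerivWithinAt Λ Λ' s t)
    (hx : HasDerivWithinAt x (A *ᵥ x t + h) s t) :
    HasDerivWithinAt (fun τ => x τ ⬝ᵥ (Λ τ *ᵥ x τ))
      (x t ⬝ᵥ ((Λ' + Aᵀ * Λ t + Λ t * A) *ᵥ x t) + 2 * (x t ⬝ᵥ (Λ t *ᵥ h))) s t := by
  have hAx : x t ⬝ᵥ (Aᵀ *ᵥ (Λ t *ᵥ x t)) = (A *ᵥ x t) ⬝ᵥ (Λ t *ᵥ x t) := by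
    rw [Matrix.dotProduct_transpose_mulVec, dotProduct_comm]
  have hhx : h ⬝ᵥ (Λ t *ᵥ x t) = x t ⬝ᵥ (Λ t *ᵥ h) := by
    rw [← Matrix.dotProduct_transpose_mulVec, hsymm.eq]
  convert hasDerivWithinAt_dotProduct hx (hasDerivWithinAt_mulVec hΛ hx) using 1
  simp only [Matrix.add_mulVec, Matrix.mulVec_add, dotProduct_add, add_dotProduct, hAx, hhx,
    ← Matrix.mulVec_mulVec]
  ring

end MatrixFunctions

/-! ### Lyapunov matrices -/

/-- `Λ` makes `vᵀ Λ(t) v` a strict quadratic Lyapunov function for `ẋ = A(t) x` on `[0, ∞)`: along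
solutions its derivative `vᵀ (Λ̇ + Aᵀ Λ + Λ A) v` is at most `-δ vᵀ v`. As `A` is only piecewise
continuous, a locally finite set of times is exempt. -/
structure IsLyapunovMatrix {ι : Type*} [Fintype ι] (A Λ : ℝ → Matrix ι ι ℝ) : Prop where
  continuousOn : ContinuousOn Λ (Ici 0)
  isSymm : ∀ t, 0 ≤ t → (Λ t).IsSymm
  bounded : BoundedEntries Λ
  coercive : ∃ m > 0, ∀ t, 0 ≤ t → ∀ v, m * (v ⬝ᵥ v) ≤ v ⬝ᵥ (Λ t *ᵥ v)
  decay : ∃ δ > 0, ∃ D, LocallyFiniteTimes D ∧ ∀ t, 0 ≤ t → t ∉ D →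
    ∃ Λ', HasDerivWithinAt Λ Λ' (Ici 0) t ∧
      ∀ v, v ⬝ᵥ ((Λ' + (A t)ᵀ * Λ t + Λ t * A t) *ᵥ v) ≤ -δ * (v ⬝ᵥ v)

section IndirectMethod

variable {n : ℕ} {A Λ : ℝ → Mat n n}

lemma norm_sq_eq_dotProduct (v : Vec n) : ‖v‖ ^ 2 = v.ofLp ⬝ᵥ v.ofLp := by
  rw [EuclideanSpace.real_norm_sq_eq]
  simp only [dotProduct, sq]

lemma IsLyapunovMatrix.exists_perturbed_decay (hΛ : IsLyapunovMatrix A Λ) {η : ℝ → Vec n → Vec n}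
    {ε κ : ℝ} (hε : 0 < ε)
    (hη : ∀ t, 0 ≤ t → ∀ e, ‖e‖ ≤ ε → ‖η t e‖ ≤ κ * ‖e‖ ^ 2) :
    ∃ δ > 0, ∃ r > 0, ∃ D, LocallyFiniteTimes D ∧ ∀ t, 0 ≤ t → t ∉ D →
      ∃ Λ', HasDerivWithinAt Λ Λ' (Ici 0) t ∧ ∀ e, ‖e‖ < r →
        e.ofLp ⬝ᵥ ((Λ' + (A t)ᵀ * Λ t + Λ t * A t) *ᵥ e.ofLp) +
          2 * (e.ofLp ⬝ᵥ (Λ t *ᵥ (η t e).ofLp)) ≤ -δ * ‖e‖ ^ 2 := by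
  obtain ⟨δ, hδ, D, hD, hdecay⟩ := hΛ.decay
  obtain ⟨c, hc, hyoung⟩ := hΛ.bounded.exists_two_mul_dotProduct_mulVec_le (half_pos hδ)
  obtain ⟨r, hr, hsmall⟩ : ∃ r > 0, ∀ s, 0 ≤ s → s < r → c * (κ * s) ^ 2 ≤ δ / 4 := by
    have htends : Tendsto (fun s : ℝ => c * (κ * s) ^ 2) (𝓝 0) (𝓝 0) := by
      refine Continuous.tendsto' (by fun_prop) _ _ (by simp)
    obtain ⟨r, hr, hball⟩ := Metric.eventually_nhds_iff.1
      (htends.eventually (eventually_le_nhds (show (0 : ℝ) < δ / 4 by positivity)))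
    exact ⟨r, hr, fun s hs hsr => hball (by simpa [abs_of_nonneg hs] using hsr)⟩
  refine ⟨δ / 4, by positivity, min ε r, lt_min hε hr, D, hD, fun t ht htD => ?_⟩
  obtain ⟨Λ', hΛ', hle⟩ := hdecay t ht htD
  refine ⟨Λ', hΛ', fun e he => ?_⟩
  have hquad : c * ‖η t e‖ ^ 2 ≤ δ / 4 * ‖e‖ ^ 2 :=
    calc c * ‖η t e‖ ^ 2 ≤ c * (κ * ‖e‖ ^ 2) ^ 2 := by
          gcongr
          exact hη t ht e (he.le.trans (min_le_left _ _))
      _ = c * (κ * ‖e‖) ^ 2 * ‖e‖ ^ 2 := by ring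
      _ ≤ δ / 4 * ‖e‖ ^ 2 := by
          gcongr
          exact hsmall _ (norm_nonneg e) (he.trans_le (min_le_right _ _))
  have hcross := hyoung t ht e.ofLp (η t e).ofLp
  have hmain := hle e.ofLp
  rw [← norm_sq_eq_dotProduct] at hcross hmain
  rw [← norm_sq_eq_dotProduct] at hcross
  linarith

theorem IsLyapunovMatrix.locallyUniformlyExpStable (hΛ : IsLyapunovMatrix A Λ)
    {η : ℝ → Vec n → Vec n}
    (hη : ∃ ε κ : ℝ, 0 < ε ∧ ∀ t, 0 ≤ t → ∀ e, ‖e‖ ≤ ε → ‖η t e‖ ≤ κ * ‖e‖ ^ 2) :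
    LocallyUniformlyExpStable fun t e => matVec (A t) e + η t e := by
  obtain ⟨ε, κ, hε, hη⟩ := hη
  obtain ⟨m, hm, hlow⟩ := hΛ.coercive
  obtain ⟨M, hM, hyoung⟩ := hΛ.bounded.exists_two_mul_dotProduct_mulVec_le one_pos
  have hη0 : ∀ t, 0 ≤ t → η t 0 = 0 := fun t ht => by simpa using hη t ht 0 (by simpa using hε.le)
  have hupp : ∀ t, 0 ≤ t → ∀ e : Vec n,
      e.ofLp ⬝ᵥ (Λ t *ᵥ e.ofLp) ≤ max m (1 + M) * ‖e‖ ^ 2 := fun t ht e => by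
    have hVe := hyoung t ht e.ofLp e.ofLp
    have hmax : (1 + M) * ‖e‖ ^ 2 ≤ max m (1 + M) * ‖e‖ ^ 2 := by gcongr; exact le_max_right _ _
    rw [← norm_sq_eq_dotProduct] at hVe
    nlinarith [norm_nonneg e, sq_nonneg ‖e‖]
  obtain ⟨δ, hδ, r, hr, D, hD, hdecay⟩ := hΛ.exists_perturbed_decay hε hη
  have hmax : 0 < max m (1 + M) := hm.trans_le (le_max_left _ _)
  refine locallyUniformlyExpStable_of_lyapunov (V := fun t e => e.ofLp ⬝ᵥ (Λ t *ᵥ e.ofLp))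
    (c := δ / max m (1 + M)) (fun t ht => by simp [hη0 t ht]) hm (le_max_left _ _) (by positivity)
    hr (fun t ht e => by simpa only [norm_sq_eq_dotProduct] using hlow t ht e.ofLp) hupp
    fun t₀ T ht₀ e ⟨hcont, De, hDe, hode⟩ => ⟨?_, D ∪ De, hD.union hDe, fun t ht htD her => ?_⟩
  · have hΛcont := continuousOn_matrix.1
      (hΛ.continuousOn.mono fun t (ht : t ∈ Icc t₀ T) => ht₀.trans ht.1)
    simp only [dotProduct, Matrix.mulVec]
    fun_prop
  · have ht0 : 0 < t := ht₀.trans_lt ht.1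
    obtain ⟨htD, htDe⟩ := not_or.1 htD
    obtain ⟨Λ', hΛ', hle⟩ := hdecay t ht0.le htD
    have hder := (PiLp.hasFDerivAt_ofLp (𝕜 := ℝ) 2 (e t)).comp_hasDerivAt t
      ((hode t (Ioo_subset_Icc_self ht) htDe).hasDerivAt (Icc_mem_nhds ht.1 ht.2))
    refine ⟨_, ?_, (hasDerivWithinAt_quadraticForm (hΛ.isSymm t ht0.le) hΛ'
      hder.hasDerivWithinAt).hasDerivAt (Ici_mem_nhds ht0)⟩
    calc _ ≤ -δ * ‖e t‖ ^ 2 := hle (e t) her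
      _ ≤ -(δ / max m (1 + M)) * (max m (1 + M) * ‖e t‖ ^ 2) := by
          rw [← mul_assoc, neg_mul, neg_mul, neg_mul, div_mul_cancel₀ _ hmax.ne']
      _ ≤ -(δ / max m (1 + M)) * ((e t).ofLp ⬝ᵥ (Λ t *ᵥ (e t).ofLp)) :=
          mul_le_mul_of_nonpos_left (hupp t ht0.le _) (neg_nonpos.2 (by positivity))

end IndirectMethod

section Operations

variable {ι κ : Type*} [Fintype ι] [Fintype κ]

lemma dotProduct_transpose_mul_mul_mulVec (W : Matrix ι κ ℝ) (N : Matrix ι ι ℝ) (v : κ → ℝ) :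
    v ⬝ᵥ ((Wᵀ * N * W) *ᵥ v) = (W *ᵥ v) ⬝ᵥ (N *ᵥ (W *ᵥ v)) := by
  rw [Matrix.mul_assoc, ← Matrix.mulVec_mulVec, Matrix.dotProduct_transpose_mulVec, dotProduct_comm,
    ← Matrix.mulVec_mulVec]

lemma mulVec_dotProduct_self_of_transpose_mul_self_eq_one [DecidableEq κ] {W : Matrix ι κ ℝ}
    (hW : Wᵀ * W = 1) (v : κ → ℝ) : (W *ᵥ v) ⬝ᵥ (W *ᵥ v) = v ⬝ᵥ v := by
  rw [← Matrix.dotProduct_transpose_mulVec, Matrix.mulVec_mulVec, hW, Matrix.one_mulVec]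

lemma dotProduct_fromBlocks_mulVec (M : Matrix ι ι ℝ) (G : Matrix ι κ ℝ) (N : Matrix κ κ ℝ)
    (v : ι ⊕ κ → ℝ) :
    v ⬝ᵥ (Matrix.fromBlocks M G Gᵀ N *ᵥ v) =
      (v ∘ Sum.inl) ⬝ᵥ (M *ᵥ (v ∘ Sum.inl)) + 2 * ((v ∘ Sum.inl) ⬝ᵥ (G *ᵥ (v ∘ Sum.inr))) +
        (v ∘ Sum.inr) ⬝ᵥ (N *ᵥ (v ∘ Sum.inr)) := by
  rw [Matrix.fromBlocks_mulVec, Matrix.dotProduct_block, Sum.elim_comp_inl, Sum.elim_comp_inr,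
    dotProduct_add, dotProduct_add, Matrix.dotProduct_transpose_mulVec]
  ring

lemma min_mul_dotProduct_self_le (a b : ℝ) (v : ι ⊕ κ → ℝ) :
    min a b * (v ⬝ᵥ v) ≤ a * ((v ∘ Sum.inl) ⬝ᵥ (v ∘ Sum.inl)) +
      b * ((v ∘ Sum.inr) ⬝ᵥ (v ∘ Sum.inr)) := by
  rw [Matrix.dotProduct_block, mul_add]
  gcongr
  · exact dotProduct_self_nonneg _
  · exact min_le_left a b
  · exact dotProduct_self_nonneg _
  · exact min_le_right a b

lemma min_mul_dotProduct_self_le_fromBlocks {a b : ℝ} {M : Matrix ι ι ℝ} {N : Matrix κ κ ℝ}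
    (hM : ∀ x, a * (x ⬝ᵥ x) ≤ x ⬝ᵥ (M *ᵥ x)) (hN : ∀ y, b * (y ⬝ᵥ y) ≤ y ⬝ᵥ (N *ᵥ y))
    (v : ι ⊕ κ → ℝ) : min a b * (v ⬝ᵥ v) ≤ v ⬝ᵥ (Matrix.fromBlocks M 0 0 N *ᵥ v) := by
  have hblocks := dotProduct_fromBlocks_mulVec M 0 N v
  rw [Matrix.transpose_zero, Matrix.zero_mulVec, dotProduct_zero, mul_zero, add_zero] at hblocks
  rw [hblocks]
  exact (min_mul_dotProduct_self_le a b v).trans (add_le_add (hM _) (hN _))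

lemma fromBlocks_lyapunov_operator {A₁ Λ₁ Λ₁' : Matrix ι ι ℝ} {A₂ Λ₂ Λ₂' : Matrix κ κ ℝ}
    {F : Matrix ι κ ℝ} (γ : ℝ) (hΛ₁ : Λ₁.IsSymm) :
    Matrix.fromBlocks Λ₁' 0 0 (γ • Λ₂') +
        (Matrix.fromBlocks A₁ F 0 A₂)ᵀ * Matrix.fromBlocks Λ₁ 0 0 (γ • Λ₂) +
        Matrix.fromBlocks Λ₁ 0 0 (γ • Λ₂) * Matrix.fromBlocks A₁ F 0 A₂ =
      Matrix.fromBlocks (Λ₁' + A₁ᵀ * Λ₁ + Λ₁ * A₁) (Λ₁ * F) (Λ₁ * F)ᵀ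
        (γ • (Λ₂' + A₂ᵀ * Λ₂ + Λ₂ * A₂)) := by
  simp [Matrix.fromBlocks_transpose, Matrix.fromBlocks_multiply, Matrix.fromBlocks_add,
    Matrix.transpose_mul, hΛ₁.eq, smul_add]

lemma IsLyapunovMatrix.congr {A B Λ : ℝ → Matrix ι ι ℝ} (h : IsLyapunovMatrix A Λ)
    (hAB : ∀ t, 0 ≤ t → A t = B t) : IsLyapunovMatrix B Λ where
  __ := h
  decay := by
    obtain ⟨δ, hδ, D, hD, hdecay⟩ := h.decay
    exact ⟨δ, hδ, D, hD, fun t ht htD => hAB t ht ▸ hdecay t ht htD⟩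

lemma hasDerivWithinAt_fromBlocks_diagonal {ι κ : Type*} [Finite ι] [Finite κ]
    {M : ℝ → Matrix ι ι ℝ} {N : ℝ → Matrix κ κ ℝ}
    {M' : Matrix ι ι ℝ} {N' : Matrix κ κ ℝ} {s : Set ℝ} {t : ℝ} (hM : HasDerivWithinAt M M' s t)
    (hN : HasDerivWithinAt N N' s t) :
    HasDerivWithinAt (fun τ => Matrix.fromBlocks (M τ) 0 0 (N τ))
      (Matrix.fromBlocks M' 0 0 N') s t := by
  refine hasDerivWithinAt_matrix.2 ?_
  rintro (i | i) (j | j)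
  exacts [hasDerivWithinAt_matrix.1 hM i j, hasDerivWithinAt_const _ _ _,
    hasDerivWithinAt_const _ _ _, hasDerivWithinAt_matrix.1 hN i j]

/-- The coupling `F` is absorbed by giving the driving subsystem a large weight `γ`. -/
theorem IsLyapunovMatrix.exists_fromBlocks {A₁ Λ₁ : ℝ → Matrix ι ι ℝ} {A₂ Λ₂ : ℝ → Matrix κ κ ℝ}
    {F : ℝ → Matrix ι κ ℝ} (h₁ : IsLyapunovMatrix A₁ Λ₁) (h₂ : IsLyapunovMatrix A₂ Λ₂)
    (hF : BoundedEntries F) :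
    ∃ γ : ℝ, IsLyapunovMatrix (fun t => Matrix.fromBlocks (A₁ t) (F t) 0 (A₂ t))
      fun t => Matrix.fromBlocks (Λ₁ t) 0 0 (γ • Λ₂ t) := by
  classical
  obtain ⟨m₁, hm₁, hlow₁⟩ := h₁.coercive
  obtain ⟨m₂, hm₂, hlow₂⟩ := h₂.coercive
  obtain ⟨δ₁, hδ₁, D₁, hD₁, hdecay₁⟩ := h₁.decay
  obtain ⟨δ₂, hδ₂, D₂, hD₂, hdecay₂⟩ := h₂.decay
  obtain ⟨c, hc, hcross⟩ :=
    (h₁.bounded.mul hF).exists_two_mul_dotProduct_mulVec_le (half_pos hδ₁)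
  obtain ⟨γ, hγ, hγδ⟩ : ∃ γ > 0, γ * δ₂ = c + 1 :=
    ⟨(c + 1) / δ₂, by positivity, div_mul_cancel₀ _ hδ₂.ne'⟩
  refine ⟨γ, ?_, fun t ht => ?_, ?_, ⟨min m₁ (γ * m₂), by positivity, fun t ht v => ?_⟩,
    ⟨min (δ₁ / 2) 1, by positivity, D₁ ∪ D₂, hD₁.union hD₂, fun t ht htD => ?_⟩⟩
  · refine continuousOn_matrix.2 ?_
    rintro (i | i) (j | j)
    exacts [continuousOn_matrix.1 h₁.continuousOn i j, continuousOn_const, continuousOn_const,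
      (continuousOn_matrix.1 h₂.continuousOn i j).const_smul γ]
  · exact (h₁.isSymm t ht).fromBlocks Matrix.transpose_zero ((h₂.isSymm t ht).smul γ)
  · rintro (i | i) (j | j)
    exacts [h₁.bounded i j, isBigO_zero _ _, isBigO_zero _ _, (h₂.bounded i j).const_mul_left γ]
  · refine min_mul_dotProduct_self_le_fromBlocks (hlow₁ t ht) (fun y => ?_) v
    rw [Matrix.smul_mulVec, dotProduct_smul, smul_eq_mul, mul_assoc]
    exact mul_le_mul_of_nonneg_left (hlow₂ t ht y) hγ.le
  · obtain ⟨htD₁, htD₂⟩ := not_or.1 htD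
    obtain ⟨Λ₁', hΛ₁', hle₁⟩ := hdecay₁ t ht htD₁
    obtain ⟨Λ₂', hΛ₂', hle₂⟩ := hdecay₂ t ht htD₂
    refine ⟨_, hasDerivWithinAt_fromBlocks_diagonal hΛ₁' (hΛ₂'.const_smul γ), fun v => ?_⟩
    rw [fromBlocks_lyapunov_operator γ (h₁.isSymm t ht), dotProduct_fromBlocks_mulVec,
      Matrix.smul_mulVec, dotProduct_smul, smul_eq_mul]
    have hx := hle₁ (v ∘ Sum.inl)
    have hxy := hcross t ht (v ∘ Sum.inl) (v ∘ Sum.inr)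
    have hy := mul_le_mul_of_nonneg_left (hle₂ (v ∘ Sum.inr)) hγ.le
    rw [← mul_assoc, mul_neg, hγδ] at hy
    linarith [min_mul_dotProduct_self_le (δ₁ / 2) 1 v]

end Operations

section CoordinateChange

variable {ι κ : Type} [Fintype ι] [Fintype κ]

/-- The coordinates `z = W x` turn `ẋ = A x` into `ż = M z`. -/
theorem IsLyapunovMatrix.pullback [DecidableEq κ] {A : ℝ → Matrix κ κ ℝ} {M Λ : ℝ → Matrix ι ι ℝ}
    {W : ℝ → Matrix ι κ ℝ} (hΛ : IsLyapunovMatrix M Λ) (hW : ∀ t, 0 ≤ t → (W t)ᵀ * W t = 1)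
    (hode : SolvesOn (Ici 0) W fun t => M t * W t - W t * A t) :
    IsLyapunovMatrix A fun t => (W t)ᵀ * Λ t * W t where
  continuousOn := by
    have hΛc := continuousOn_matrix.1 hΛ.continuousOn
    have hWc := continuousOn_matrix.1 hode.1
    refine continuousOn_matrix.2 fun i j => ?_
    simp only [Matrix.mul_apply, Matrix.transpose_apply]
    fun_prop
  isSymm t ht := by
    rw [Matrix.IsSymm, Matrix.transpose_mul, Matrix.transpose_mul, Matrix.transpose_transpose,
      (hΛ.isSymm t ht).eq, Matrix.mul_assoc]
  bounded :=
    have hWb := BoundedEntries.of_transpose_mul_self_eq_one hW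
    (hWb.transpose.mul hΛ.bounded).mul hWb
  coercive := by
    obtain ⟨m, hm, hle⟩ := hΛ.coercive
    refine ⟨m, hm, fun t ht v => ?_⟩
    rw [dotProduct_transpose_mul_mul_mulVec,
      ← mulVec_dotProduct_self_of_transpose_mul_self_eq_one (hW t ht)]
    exact hle t ht _
  decay := by
    obtain ⟨δ, hδ, D, hD, hdecay⟩ := hΛ.decay
    obtain ⟨-, DW, hDW, hder⟩ := hode
    refine ⟨δ, hδ, D ∪ DW, hD.union hDW, fun t ht htD => ?_⟩
    obtain ⟨htD, htDW⟩ := not_or.1 htD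
    obtain ⟨Λ', hΛ', hle⟩ := hdecay t ht htD
    have hW' := hder t ht htDW
    refine ⟨_, hasDerivWithinAt_matrix_mul
      (hasDerivWithinAt_matrix_mul (hasDerivWithinAt_transpose hW') hΛ') hW', fun v => ?_⟩
    have hcongr : ((M t * W t - W t * A t)ᵀ * Λ t + (W t)ᵀ * Λ') * W t +
          (W t)ᵀ * Λ t * (M t * W t - W t * A t) + (A t)ᵀ * ((W t)ᵀ * Λ t * W t) +
          (W t)ᵀ * Λ t * W t * A t =
        (W t)ᵀ * (Λ' + (M t)ᵀ * Λ t + Λ t * M t) * W t := by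
      simp only [Matrix.transpose_sub, Matrix.transpose_mul, Matrix.mul_add, Matrix.add_mul,
        Matrix.mul_sub, Matrix.sub_mul, Matrix.mul_assoc]
      abel
    rw [hcongr, dotProduct_transpose_mul_mul_mulVec,
      ← mulVec_dotProduct_self_of_transpose_mul_self_eq_one (hW t ht)]
    exact hle _

theorem IsLyapunovMatrix.exists_of_submatrix {A : ℝ → Matrix κ κ ℝ} {Λ : ℝ → Matrix ι ι ℝ}
    (e : ι ≃ κ) (hΛ : IsLyapunovMatrix (fun t => (A t).submatrix e e) Λ) :
    ∃ Λ', IsLyapunovMatrix A Λ' := by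
  classical
  refine ⟨_, hΛ.pullback (W := fun _ => (1 : Matrix κ κ ℝ).submatrix e id) (fun t _ => ?_) ?_⟩
  · rw [Matrix.transpose_submatrix, Matrix.transpose_one, Matrix.submatrix_mul_equiv, one_mul,
      Matrix.submatrix_id_id]
  · refine ⟨continuousOn_const, ∅, fun _ => by simp, fun t _ _ => ?_⟩
    have hzero : (A t).submatrix e e * (1 : Matrix κ κ ℝ).submatrix e id -
        (1 : Matrix κ κ ℝ).submatrix e id * A t = 0 := by
      ext i j
      simp [Matrix.mul_apply, Matrix.one_apply]
    simpa only [hzero] using hasDerivWithinAt_const t (Ici 0) _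

end CoordinateChange

/-! ### The Riccati equation -/

section Riccati

variable {k m : ℕ} {P M : Mat k k} {p : ℝ}

lemma LoewnerLE.dotProduct_mulVec_le {N : Mat k k} (h : LoewnerLE M N) (v : Fin k → ℝ) :
    v ⬝ᵥ (M *ᵥ v) ≤ v ⬝ᵥ (N *ᵥ v) := by
  simpa only [star_trivial, Matrix.sub_mulVec, dotProduct_sub, sub_nonneg] using
    Matrix.PosSemidef.dotProduct_mulVec_nonneg h v

lemma dotProduct_smul_one_mulVec (p : ℝ) (v : Fin k → ℝ) :
    v ⬝ᵥ ((p • (1 : Mat k k)) *ᵥ v) = p * (v ⬝ᵥ v) := by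
  rw [Matrix.smul_mulVec, Matrix.one_mulVec, dotProduct_smul, smul_eq_mul]

lemma LoewnerLE.mul_dotProduct_self_le (h : LoewnerLE (p • 1) P) (v : Fin k → ℝ) :
    p * (v ⬝ᵥ v) ≤ v ⬝ᵥ (P *ᵥ v) :=
  dotProduct_smul_one_mulVec p v ▸ h.dotProduct_mulVec_le v

lemma LoewnerLE.le_mul_dotProduct_self (h : LoewnerLE P (p • 1)) (v : Fin k → ℝ) :
    v ⬝ᵥ (P *ᵥ v) ≤ p * (v ⬝ᵥ v) :=
  dotProduct_smul_one_mulVec p v ▸ h.dotProduct_mulVec_le v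

lemma LoewnerLE.posDef (h : LoewnerLE (p • 1) P) (hp : 0 < p) : P.PosDef := by
  simpa using Matrix.PosDef.posSemidef_add h (Matrix.PosDef.one.smul hp)

lemma LoewnerLE.mulVec_dotProduct_self_le (h : LoewnerLE P (p • 1)) (hP : P.PosSemidef)
    (hp : 0 < p) (v : Fin k → ℝ) : (P *ᵥ v) ⬝ᵥ (P *ᵥ v) ≤ p * (v ⬝ᵥ (P *ᵥ v)) := by
  have hsymm : P.IsSymm := hP.isHermitian
  have hpos := hP.dotProduct_mulVec_nonneg (p • v - P *ᵥ v)
  have hcross : (P *ᵥ v) ⬝ᵥ (P *ᵥ v) = v ⬝ᵥ (P *ᵥ (P *ᵥ v)) := by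
    rw [← Matrix.dotProduct_transpose_mulVec, hsymm.eq]
  have hle := h.le_mul_dotProduct_self (P *ᵥ v)
  simp only [star_trivial, Matrix.mulVec_sub, Matrix.mulVec_smul, sub_dotProduct, dotProduct_sub,
    smul_dotProduct, dotProduct_smul, smul_eq_mul, ← hcross] at hpos
  have hscaled : 0 ≤ p * (p * (v ⬝ᵥ (P *ᵥ v)) - (P *ᵥ v) ⬝ᵥ (P *ᵥ v)) := by linarith
  linarith [nonneg_of_mul_nonneg_right hscaled hp]

lemma hasDerivWithinAt_matrix_inv {ι : Type*} [Fintype ι] [DecidableEq ι]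
    {P : ℝ → Matrix ι ι ℝ} {P' : Matrix ι ι ℝ} {s : Set ℝ} {t : ℝ}
    (hP : HasDerivWithinAt P P' s t) (hu : IsUnit (P t)) :
    HasDerivWithinAt (fun τ => (P τ)⁻¹) (-((P t)⁻¹ * P' * (P t)⁻¹)) s t := by
  obtain ⟨U, hU⟩ := hu
  have hring := hasFDerivAt_ringInverse (𝕜 := ℝ) U
  have hinv : (↑U⁻¹ : Matrix ι ι ℝ) = (P t)⁻¹ := by rw [Matrix.coe_units_inv, hU]
  rw [hU, hinv] at hring
  simpa only [Function.comp_def, ← Matrix.nonsing_inv_eq_ringInverse, neg_apply,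
    ContinuousLinearMap.mulLeftRight_apply] using hring.comp_hasDerivWithinAt t hP

lemma continuousOn_matrix_inv {ι : Type*} [Fintype ι] [DecidableEq ι] {P : ℝ → Matrix ι ι ℝ}
    {s : Set ℝ} (hP : ContinuousOn P s) (hu : ∀ t ∈ s, IsUnit (P t)) :
    ContinuousOn (fun t => (P t)⁻¹) s := fun t ht => by
  obtain ⟨U, hU⟩ := hu t ht
  simp only [Matrix.nonsing_inv_eq_ringInverse]
  exact ContinuousAt.comp_continuousWithinAt (hU ▸ NormedRing.inverse_continuousAt U) (hP t ht)

lemma LoewnerLE.mulVec_inv_mulVec (h : LoewnerLE (p • 1) P) (hp : 0 < p) (v : Fin k → ℝ) :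
    P *ᵥ (P⁻¹ *ᵥ v) = v := by
  rw [Matrix.mulVec_mulVec, Matrix.mul_nonsing_inv _ (P.isUnit_iff_isUnit_det.1
    (h.posDef hp).isUnit), Matrix.one_mulVec]

lemma LoewnerLE.inv_mulVec_dotProduct_self_le (h : LoewnerLE (p • 1) P) (hp : 0 < p)
    (v : Fin k → ℝ) : (P⁻¹ *ᵥ v) ⬝ᵥ (P⁻¹ *ᵥ v) ≤ (p⁻¹) ^ 2 * (v ⬝ᵥ v) := by
  have hlow := h.mul_dotProduct_self_le (P⁻¹ *ᵥ v)
  rw [h.mulVec_inv_mulVec hp] at hlow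
  have hyoung := two_mul_dotProduct_le hp (P⁻¹ *ᵥ v) v
  rw [sq, mul_assoc, le_inv_mul_iff₀ hp]
  linarith

lemma riccati_lyapunov_operator {B G : Mat k k} {C : Mat m k} (hP : P.PosDef) :
    -(P⁻¹ * (B * P + P * Bᵀ - P * Cᵀ * C * P + G) * P⁻¹) + (B - P * Cᵀ * C)ᵀ * P⁻¹ +
        P⁻¹ * (B - P * Cᵀ * C) = -(Cᵀ * C + P⁻¹ᵀ * G * P⁻¹) := by
  have hdet := P.isUnit_iff_isUnit_det.1 hP.isUnit
  have hsymm : Pᵀ = P := hP.isHermitian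
  have hinv : P⁻¹ᵀ = P⁻¹ := by rw [Matrix.transpose_nonsing_inv, hsymm]
  simp only [Matrix.transpose_sub, Matrix.transpose_mul, Matrix.transpose_transpose, hsymm, hinv,
    Matrix.mul_add, Matrix.add_mul, Matrix.mul_sub, Matrix.sub_mul, Matrix.mul_assoc,
    Matrix.mul_nonsing_inv _ hdet, Matrix.nonsing_inv_mul_cancel_left _ _ hdet, Matrix.mul_one]
  abel

/-- The inverse of a Riccati solution solves the dual Riccati equation, in which the output and
weight terms `Cᵀ C` and `P⁻¹ G P⁻¹` are the dissipation. -/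
theorem isLyapunovMatrix_riccati_inv {B P G : ℝ → Mat k k} {C : ℝ → Mat m k} {p₁ p₂ g : ℝ}
    (hp₁ : 0 < p₁) (hp₂ : 0 < p₂) (hg : 0 < g)
    (hP : ∀ t, 0 ≤ t → LoewnerLE (p₁ • 1) (P t) ∧ LoewnerLE (P t) (p₂ • 1))
    (hG : ∀ t, 0 ≤ t → LoewnerLE (g • 1) (G t))
    (hode : SolvesOn (Ici 0) P fun t =>
      B t * P t + P t * (B t)ᵀ - P t * (C t)ᵀ * C t * P t + G t) :
    IsLyapunovMatrix (fun t => B t - P t * (C t)ᵀ * C t) fun t => (P t)⁻¹ := by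
  have hdef : ∀ t, 0 ≤ t → (P t).PosDef := fun t ht => (hP t ht).1.posDef hp₁
  have hlow : ∀ t, 0 ≤ t → ∀ v, v ⬝ᵥ v ≤ p₂ * (((P t)⁻¹ *ᵥ v) ⬝ᵥ v) := fun t ht v => by
    simpa only [(hP t ht).1.mulVec_inv_mulVec hp₁] using
      (hP t ht).2.mulVec_dotProduct_self_le (hdef t ht).posSemidef hp₂ ((P t)⁻¹ *ᵥ v)
  obtain ⟨hcont, D, hD, hderiv⟩ := hode
  refine ⟨continuousOn_matrix_inv hcont fun t ht => (hdef t ht).isUnit,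
    fun t ht => (hdef t ht).inv.isHermitian,
    .of_mulVec_dotProduct_self_le fun t ht => (hP t ht).1.inv_mulVec_dotProduct_self_le hp₁,
    ⟨p₂⁻¹, by positivity, fun t ht v => ?_⟩,
    ⟨g * p₂⁻¹ ^ 2, by positivity, D, hD, fun t ht htD => ?_⟩⟩
  · rw [inv_mul_le_iff₀ hp₂, dotProduct_comm v ((P t)⁻¹ *ᵥ v)]
    exact hlow t ht v
  · refine ⟨_, hasDerivWithinAt_matrix_inv (hderiv t ht htD) (hdef t ht).isUnit, fun v => ?_⟩
    rw [riccati_lyapunov_operator (hdef t ht), Matrix.neg_mulVec, dotProduct_neg,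
      Matrix.add_mulVec, dotProduct_add, dotProduct_transpose_mul_mul_mulVec,
      ← Matrix.mulVec_mulVec, Matrix.dotProduct_transpose_mulVec]
    have hout := dotProduct_self_nonneg (C t *ᵥ v)
    have hweight := (hG t ht).mul_dotProduct_self_le ((P t)⁻¹ *ᵥ v)
    have hy : v ⬝ᵥ v ≤ p₂ ^ 2 * (((P t)⁻¹ *ᵥ v) ⬝ᵥ ((P t)⁻¹ *ᵥ v)) := by
      have hupper := (hP t ht).2.le_mul_dotProduct_self ((P t)⁻¹ *ᵥ v)
      rw [(hP t ht).1.mulVec_inv_mulVec hp₁] at hupper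
      calc v ⬝ᵥ v ≤ p₂ * (((P t)⁻¹ *ᵥ v) ⬝ᵥ v) := hlow t ht v
        _ ≤ p₂ * (p₂ * (((P t)⁻¹ *ᵥ v) ⬝ᵥ ((P t)⁻¹ *ᵥ v))) := by gcongr
        _ = p₂ ^ 2 * (((P t)⁻¹ *ᵥ v) ⬝ᵥ ((P t)⁻¹ *ᵥ v)) := by ring
    rw [← inv_mul_le_iff₀ (by positivity), ← inv_pow] at hy
    linarith [mul_le_mul_of_nonneg_left hy hg.le]

lemma BoundedEntries.of_loewnerLE {P : ℝ → Mat k k} (hp : 0 < p)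
    (hP : ∀ t, 0 ≤ t → (P t).PosSemidef ∧ LoewnerLE (P t) (p • 1)) : BoundedEntries P :=
  .of_mulVec_dotProduct_self_le (c := p * p) fun t ht v => by
    rw [mul_assoc]
    exact ((hP t ht).2.mulVec_dotProduct_self_le (hP t ht).1 hp v).trans
      (mul_le_mul_of_nonneg_left ((hP t ht).2.le_mul_dotProduct_self v) hp.le)

end Riccati

lemma MatSolves.solvesOn {n k : ℕ} {M V : ℝ → Mat n k} (h : MatSolves M V) :
    SolvesOn (Ici 0) M V := by
  choose hcont D hD hderiv using h
  exact ⟨continuousOn_matrix.2 hcont, ⋃ i, ⋃ j, D i j,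
    LocallyFiniteTimes.iUnion fun i => LocallyFiniteTimes.iUnion fun j => hD i j,
    fun t ht htD => hasDerivWithinAt_matrix.2 fun i j => hderiv i j t ht fun htij =>
      htD (mem_iUnion₂.2 ⟨i, j, htij⟩)⟩

/-! ### Negative upper Bohl exponents -/

section Bohl

variable {b g φ : ℝ → ℝ} {a σ : ℝ} {D : Set ℝ}

lemma LocallyFiniteTimes.countable_inter_Ici (hD : LocallyFiniteTimes D) :
    (D ∩ Ici 0).Countable := by
  refine (countable_iUnion fun T : ℕ => (hD T).countable).mono fun t ht => ?_
  obtain ⟨T, hT⟩ := exists_nat_ge t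
  exact mem_iUnion.2 ⟨T, ht.1, ht.2, hT⟩

lemma locallyIntegrableOn_of_abs_le (hb : ∀ t, 0 ≤ t → |b t| ≤ a) (hD : LocallyFiniteTimes D)
    (hcont : ∀ t, 0 ≤ t → t ∉ D → ContinuousWithinAt b (Ici 0) t) :
    LocallyIntegrableOn b (Ici 0) := by
  have hae : (Ici 0 \ D : Set ℝ) =ᵐ[volume] Ici 0 := by
    rw [← sdiff_inter_self_eq_sdiff]
    exact sdiff_null_ae_eq_self (hD.countable_inter_Ici.measure_zero volume)
  have hmeas : AEStronglyMeasurable b (volume.restrict (Ici 0)) := by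
    rw [← Measure.restrict_congr_set hae]
    have hsdiff : MeasurableSet (Ici 0 \ D) := by
      rw [← sdiff_inter_self_eq_sdiff]
      exact measurableSet_Ici.diff hD.countable_inter_Ici.measurableSet
    exact ContinuousOn.aestronglyMeasurable
      (fun t ht => (hcont t ht.1 ht.2).mono sdiff_subset) hsdiff
  rw [locallyIntegrableOn_iff_locallyIntegrable_restrict isClosed_Ici]
  refine (locallyIntegrable_const a).mono hmeas ?_
  filter_upwards [ae_restrict_mem measurableSet_Ici] with t ht
  exact (hb t ht).trans (le_abs_self a)

lemma intervalIntegrable_of_locallyIntegrableOn_Ici (hg : LocallyIntegrableOn g (Ici 0)) {s t : ℝ}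
    (hs : 0 ≤ s) (ht : 0 ≤ t) : IntervalIntegrable g volume s t :=
  (hg.integrableOn_compact_subset (fun _ hτ => (le_min hs ht).trans hτ.1)
    isCompact_uIcc).intervalIntegrable

lemma hasDerivAt_integral_of_locallyIntegrableOn_Ici (hg : LocallyIntegrableOn g (Ici 0)) {t : ℝ}
    (ht : 0 < t) (hcont : ContinuousWithinAt g (Ici 0) t) :
    HasDerivAt (fun s => ∫ τ in (0 : ℝ)..s, g τ) (g t) t :=
  intervalIntegral.integral_hasDerivAt_right
    (intervalIntegrable_of_locallyIntegrableOn_Ici hg le_rfl ht.le)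
    ⟨Ici 0, Ici_mem_nhds ht, hg.aestronglyMeasurable⟩ (hcont.continuousAt (Ici_mem_nhds ht))

lemma continuousOn_integral_of_locallyIntegrableOn_Ici (hg : LocallyIntegrableOn g (Ici 0)) :
    ContinuousOn (fun s => ∫ τ in (0 : ℝ)..s, g τ) (Ici 0) := by
  intro t (ht : 0 ≤ t)
  have hle : (0 : ℝ) ≤ t + 1 := by positivity
  have hint : IntegrableOn g (uIcc 0 (t + 1)) :=
    hg.integrableOn_compact_subset (uIcc_of_le hle ▸ Icc_subset_Ici_self) isCompact_uIcc
  have hmem : uIcc 0 (t + 1) ∈ 𝓝[Ici 0] t := by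
    rw [uIcc_of_le hle, ← Ici_inter_Iic]
    exact inter_mem_nhdsWithin _ (Iic_mem_nhds (lt_add_one t))
  exact (intervalIntegral.continuousOn_primitive_interval hint t
    (uIcc_of_le hle ▸ ⟨ht, (lt_add_one t).le⟩)).mono_of_mem_nhdsWithin hmem

lemma integral_sub_integral_of_locallyIntegrableOn_Ici (hg : LocallyIntegrableOn g (Ici 0))
    {s t : ℝ} (hs : 0 ≤ s) (ht : 0 ≤ t) :
    (∫ τ in (0 : ℝ)..t, g τ) - ∫ τ in (0 : ℝ)..s, g τ = ∫ τ in s..t, g τ :=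
  intervalIntegral.integral_interval_sub_left
    (intervalIntegrable_of_locallyIntegrableOn_Ici hg le_rfl ht)
    (intervalIntegrable_of_locallyIntegrableOn_Ici hg le_rfl hs)

lemma abs_integral_le_mul_sub (hb : ∀ t, 0 ≤ t → |b t| ≤ a) {s t : ℝ} (hs : 0 ≤ s) (hst : s ≤ t) :
    |∫ τ in s..t, b τ| ≤ a * (t - s) := by
  rw [← abs_of_nonneg (sub_nonneg.2 hst), ← Real.norm_eq_abs]
  refine intervalIntegral.norm_integral_le_of_norm_le_const fun τ hτ => hb τ ?_
  exact hs.trans (uIoc_of_le hst ▸ hτ).1.le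

lemma exists_forall_integral_lt_of_upperBohl_lt (hb : ∀ t, 0 ≤ t → |b t| ≤ a) {r : ℝ}
    (hr : upperBohl b < r) :
    ∃ T > 0, ∃ S > 0, ∀ t s, T ≤ t → S ≤ s → ∫ τ in t..t + s, b τ < r * s := by
  have hbdd : ∀ᶠ q : ℝ × ℝ in atTop ×ˢ atTop, (1 / q.2) * ∫ τ in q.1..(q.1 + q.2), b τ ≤ a := by
    filter_upwards [prod_mem_prod (eventually_ge_atTop (0 : ℝ)) (eventually_gt_atTop (0 : ℝ))]
      with ⟨t, s⟩ ⟨(ht : 0 ≤ t), (hs : 0 < s)⟩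
    rw [one_div, inv_mul_le_iff₀ hs, mul_comm]
    simpa using (le_abs_self _).trans
      (abs_integral_le_mul_sub hb ht (le_add_of_nonneg_right hs.le))
  obtain ⟨p, hp, p', hp', hmean⟩ :=
    eventually_prod_iff.1 (eventually_lt_of_limsup_lt hr ⟨a, eventually_map.2 hbdd⟩)
  obtain ⟨T, hT⟩ := (hp.and (eventually_gt_atTop 0)).exists_forall_of_atTop
  obtain ⟨S, hS⟩ := (hp'.and (eventually_gt_atTop 0)).exists_forall_of_atTop
  refine ⟨T, (hT T le_rfl).2, S, (hS S le_rfl).2, fun t s ht hs => ?_⟩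
  have hlt := hmean (hT t ht).1 (hS s hs).1
  rwa [one_div, inv_mul_lt_iff₀ (hS s hs).2, mul_comm] at hlt

lemma exists_window_integral_le_neg_one (hb : ∀ t, 0 ≤ t → |b t| ≤ a)
    (hint : LocallyIntegrableOn b (Ici 0)) (hneg : upperBohl b < 0) :
    ∃ σ > 0, ∀ t, 0 ≤ t → ∫ τ in t..t + σ, b τ ≤ -1 := by
  obtain ⟨r, hr, hr₀⟩ := exists_between hneg
  obtain ⟨T, hT, S, hS, hmean⟩ := exists_forall_integral_lt_of_upperBohl_lt hb hr
  refine ⟨T + max S ((1 + a * T) / -r), by positivity, fun t ht => ?_⟩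
  set s := max S ((1 + a * T) / -r)
  have : 0 < s := hS.trans_le (le_max_left _ _)
  have htransient := (le_abs_self _).trans
    (abs_integral_le_mul_sub hb ht (le_add_of_nonneg_right hT.le))
  have htail := hmean (t + T) s (le_add_of_nonneg_left ht) (le_max_left _ _)
  have hrs : 1 + a * T ≤ s * -r := (div_le_iff₀ (neg_pos.2 hr₀)).1 (le_max_right _ _)
  rw [← add_assoc, ← intervalIntegral.integral_add_adjacent_intervals
    (intervalIntegrable_of_locallyIntegrableOn_Ici hint ht (add_nonneg ht hT.le))
    (intervalIntegrable_of_locallyIntegrableOn_Ici hint (by positivity) (by positivity))]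
  linarith

/-- The integrated squared size over the next `σ` units of time of the solution `exp (φ s - φ t)` of
`ż = φ' z` starting from `1` at time `t`. It is the truncation of the classical Lyapunov function
`∫ s in t..∞, |z s| ^ 2`, and serves as a Lyapunov weight for that equation. -/
noncomputable def windowWeight (φ : ℝ → ℝ) (σ t : ℝ) : ℝ :=
  ∫ s in t..t + σ, Real.exp (2 * (φ s - φ t))

lemma windowWeight_eq (hφ : ContinuousOn φ (Ici 0)) (hσ : 0 ≤ σ) {t : ℝ} (ht : 0 ≤ t) :
    windowWeight φ σ t = Real.exp (-2 * φ t) *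
      ((∫ s in (0 : ℝ)..t + σ, Real.exp (2 * φ s)) - ∫ s in (0 : ℝ)..t, Real.exp (2 * φ s)) := by
  have hint : LocallyIntegrableOn (fun s => Real.exp (2 * φ s)) (Ici 0) :=
    ContinuousOn.locallyIntegrableOn (by fun_prop) measurableSet_Ici
  rw [integral_sub_integral_of_locallyIntegrableOn_Ici hint ht (by positivity),
    ← intervalIntegral.integral_const_mul]
  refine intervalIntegral.integral_congr fun s _ => ?_
  simp only [← Real.exp_add]
  ring_nf

lemma continuousOn_windowWeight (hφ : ContinuousOn φ (Ici 0)) (hσ : 0 ≤ σ) :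
    ContinuousOn (windowWeight φ σ) (Ici 0) := by
  have hint : LocallyIntegrableOn (fun s => Real.exp (2 * φ s)) (Ici 0) :=
    ContinuousOn.locallyIntegrableOn (by fun_prop) measurableSet_Ici
  have hE := continuousOn_integral_of_locallyIntegrableOn_Ici hint
  refine ContinuousOn.congr ?_ fun t ht => windowWeight_eq hφ hσ ht
  have hshift := hE.comp (f := (· + σ)) (by fun_prop)
    fun t (ht : 0 ≤ t) => (add_nonneg ht hσ : t + σ ∈ Ici 0)
  exact ContinuousOn.mul (by fun_prop) (hshift.sub hE)

lemma hasDerivWithinAt_windowWeight (hφ : ContinuousOn φ (Ici 0)) (hσ : 0 ≤ σ) {t β : ℝ}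
    (ht : 0 < t) (hβ : HasDerivAt φ β t) :
    HasDerivWithinAt (windowWeight φ σ)
      (Real.exp (2 * (φ (t + σ) - φ t)) - 1 - 2 * β * windowWeight φ σ t) (Ici 0) t := by
  have hexp : ContinuousOn (fun s => Real.exp (2 * φ s)) (Ici 0) := by fun_prop
  have hint := hexp.locallyIntegrableOn measurableSet_Ici (μ := volume)
  have hE : ∀ s, 0 < s →
      HasDerivAt (fun r => ∫ τ in (0 : ℝ)..r, Real.exp (2 * φ τ)) (Real.exp (2 * φ s)) s :=
    fun s hs => hasDerivAt_integral_of_locallyIntegrableOn_Ici hint hs (hexp s hs.le)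
  have hprod := (hβ.const_mul (-2)).exp.mul
    (((hE (t + σ) (by positivity)).comp_add_const t σ).sub (hE t ht))
  refine (hprod.hasDerivWithinAt.congr (fun s hs => windowWeight_eq hφ hσ hs)
    (windowWeight_eq hφ hσ ht.le)).congr_deriv ?_
  have hone : Real.exp (-2 * φ t) * Real.exp (2 * φ t) = 1 := by
    rw [← Real.exp_add, neg_mul, neg_add_cancel, Real.exp_zero]
  have hwindow : Real.exp (-2 * φ t) * Real.exp (2 * φ (t + σ)) =
      Real.exp (2 * (φ (t + σ) - φ t)) := by
    rw [← Real.exp_add]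
    ring_nf
  rw [windowWeight_eq hφ hσ ht.le, Pi.sub_apply]
  linear_combination hwindow - hone

lemma windowWeight_mem_Icc (hφ : ContinuousOn φ (Ici 0)) (hσ : 0 ≤ σ) {t : ℝ} (ht : 0 ≤ t)
    (hlip : ∀ s, t ≤ s → |φ s - φ t| ≤ a * (s - t)) (ha : 0 ≤ a) :
    windowWeight φ σ t ∈ Icc (σ * Real.exp (-2 * (a * σ))) (σ * Real.exp (2 * (a * σ))) := by
  have hint : IntervalIntegrable (fun s => Real.exp (2 * (φ s - φ t))) volume t (t + σ) :=
    intervalIntegrable_of_locallyIntegrableOn_Ici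
      (ContinuousOn.locallyIntegrableOn (by fun_prop) measurableSet_Ici) ht (by positivity)
  have hbound : ∀ s ∈ Icc t (t + σ), |φ s - φ t| ≤ a * σ := fun s hs =>
    (hlip s hs.1).trans (mul_le_mul_of_nonneg_left (by linarith [hs.2]) ha)
  have hconst : ∀ c : ℝ, ∫ _ in t..t + σ, c = σ * c := fun c => by
    rw [intervalIntegral.integral_const, add_sub_cancel_left, smul_eq_mul]
  constructor
  · rw [← hconst]
    refine intervalIntegral.integral_mono_on (by linarith) intervalIntegrable_const hint
      fun s hs => Real.exp_le_exp.2 ?_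
    linarith [(abs_le.1 (hbound s hs)).1]
  · rw [← hconst]
    refine intervalIntegral.integral_mono_on (by linarith) hint intervalIntegrable_const
      fun s hs => Real.exp_le_exp.2 ?_
    linarith [(abs_le.1 (hbound s hs)).2]

lemma dotProduct_smul_one_lyapunov_operator {ι : Type*} [Fintype ι] [DecidableEq ι]
    (w' β w : ℝ) (v : ι → ℝ) :
    v ⬝ᵥ ((w' • (1 : Matrix ι ι ℝ) + (β • (1 : Matrix ι ι ℝ))ᵀ * w • (1 : Matrix ι ι ℝ) +
      w • (1 : Matrix ι ι ℝ) * β • (1 : Matrix ι ι ℝ)) *ᵥ v) = (w' + 2 * β * w) * (v ⬝ᵥ v) := by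
  simp only [Matrix.transpose_smul, Matrix.transpose_one, smul_mul_smul_comm, mul_one, ← add_smul,
    Matrix.smul_mulVec, Matrix.one_mulVec, dotProduct_smul, smul_eq_mul]
  ring

lemma isLyapunovMatrix_smul_one {ι : Type*} [Fintype ι] [DecidableEq ι] {w : ℝ → ℝ} {m M δ : ℝ}
    (hwc : ContinuousOn w (Ici 0)) (hm : 0 < m) (hw : ∀ t, 0 ≤ t → w t ∈ Icc m M) (hδ : 0 < δ)
    (hD : LocallyFiniteTimes D) (hdecay : ∀ t, 0 ≤ t → t ∉ D →
      ∃ w', HasDerivWithinAt w w' (Ici 0) t ∧ w' + 2 * b t * w t ≤ -δ) :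
    IsLyapunovMatrix (fun t => b t • (1 : Matrix ι ι ℝ)) fun t => w t • (1 : Matrix ι ι ℝ) where
  continuousOn := hwc.smul continuousOn_const
  isSymm t _ := Matrix.isSymm_one.smul (w t)
  bounded i j := by
    have hwb : w =O[𝓟 (Ici 0)] fun _ => (1 : ℝ) := isBigO_principal.2 ⟨M, fun t ht => by
      simpa [abs_of_nonneg (hm.le.trans (hw t ht).1)] using (hw t ht).2⟩
    simpa [mul_comm] using hwb.const_mul_left ((1 : Matrix ι ι ℝ) i j)
  coercive := ⟨m, hm, fun t ht v => by
    rw [Matrix.smul_mulVec, Matrix.one_mulVec, dotProduct_smul, smul_eq_mul]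
    exact mul_le_mul_of_nonneg_right (hw t ht).1 (dotProduct_self_nonneg v)⟩
  decay := ⟨δ, hδ, D, hD, fun t ht htD => by
    obtain ⟨w', hw', hle⟩ := hdecay t ht htD
    refine ⟨w' • 1, hw'.smul_const 1, fun v => ?_⟩
    rw [dotProduct_smul_one_lyapunov_operator]
    exact mul_le_mul_of_nonneg_right hle (dotProduct_self_nonneg v)⟩

theorem exists_isLyapunovMatrix_smul_one_of_upperBohl_neg {ι : Type*} [Fintype ι] [DecidableEq ι]
    (hb : ∀ t, 0 ≤ t → |b t| ≤ a) (hD : LocallyFiniteTimes D)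
    (hcont : ∀ t, 0 ≤ t → t ∉ D → ContinuousWithinAt b (Ici 0) t) (hneg : upperBohl b < 0) :
    ∃ Λ, IsLyapunovMatrix (fun t => b t • (1 : Matrix ι ι ℝ)) Λ := by
  have hint := locallyIntegrableOn_of_abs_le hb hD hcont
  obtain ⟨σ, hσ, hwindow⟩ := exists_window_integral_le_neg_one hb hint hneg
  set φ : ℝ → ℝ := fun t => ∫ τ in (0 : ℝ)..t, b τ
  have hφ : ContinuousOn φ (Ici 0) := continuousOn_integral_of_locallyIntegrableOn_Ici hint
  have hsub : ∀ s t, 0 ≤ s → 0 ≤ t → φ t - φ s = ∫ τ in s..t, b τ := fun s t hs ht =>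
    integral_sub_integral_of_locallyIntegrableOn_Ici hint hs ht
  have hdissipation : 0 < 1 - Real.exp (2 * -1) :=
    sub_pos.2 (Real.exp_lt_one_iff.2 (by norm_num))
  refine ⟨_, isLyapunovMatrix_smul_one (continuousOn_windowWeight hφ hσ.le) (by positivity)
    (fun t ht => windowWeight_mem_Icc hφ hσ.le ht
      (fun s hs => hsub t s ht (ht.trans hs) ▸ abs_integral_le_mul_sub hb ht hs)
      ((abs_nonneg _).trans (hb 0 le_rfl))) hdissipation
    (hD.union (.of_finite (finite_singleton 0))) fun t ht htD => ?_⟩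
  obtain ⟨htD, ht₀⟩ := not_or.1 htD
  have hpos : 0 < t := lt_of_le_of_ne ht (Ne.symm ht₀)
  have hderiv := hasDerivAt_integral_of_locallyIntegrableOn_Ici hint hpos (hcont t ht htD)
  refine ⟨_, hasDerivWithinAt_windowWeight hφ hσ.le hpos hderiv, ?_⟩
  have hdrop : Real.exp (2 * (φ (t + σ) - φ t)) ≤ Real.exp (2 * -1) := by
    rw [hsub t (t + σ) ht (by positivity)]
    gcongr
    exact hwindow t ht
  linarith

end Bohl

lemma castAdd_lt_natAdd {k l : ℕ} (i : Fin k) (j : Fin l) : Fin.castAdd l i < Fin.natAdd k j :=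
  Fin.lt_def.2 (i.isLt.trans_le (Nat.le_add_right k j))

lemma submatrix_finSumFinEquiv_eq_fromBlocks {k l : ℕ} {M : Mat (k + l) (k + l)}
    (h : ∀ i j, M (Fin.natAdd k i) (Fin.castAdd l j) = 0) :
    M.submatrix finSumFinEquiv finSumFinEquiv =
      Matrix.fromBlocks (M.submatrix (Fin.castAdd l) (Fin.castAdd l))
        (M.submatrix (Fin.castAdd l) (Fin.natAdd k)) 0
        (M.submatrix (Fin.natAdd k) (Fin.natAdd k)) := by
  ext (i | i) (j | j)
  exacts [rfl, rfl, h i j, rfl]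

theorem exists_isLyapunovMatrix_of_blockTriangular {l : ℕ} {U : ℝ → Mat l l}
    (hU : BoundedEntries U) (htri : ∀ t, 0 ≤ t → (U t).BlockTriangular id) {D : Set ℝ}
    (hD : LocallyFiniteTimes D)
    (hcont : ∀ i t, 0 ≤ t → t ∉ D → ContinuousWithinAt (fun s => U s i i) (Ici 0) t)
    (hneg : ∀ i, upperBohl (fun t => U t i i) < 0) : ∃ Λ, IsLyapunovMatrix U Λ := by
  induction l with
  | zero =>
    refine ⟨fun _ => 0, continuousOn_const, fun _ _ => Matrix.isSymm_zero, fun i => i.elim0,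
      ⟨1, one_pos, fun _ _ v => by simp⟩, ⟨1, one_pos, D, hD, fun t _ _ =>
        ⟨0, hasDerivWithinAt_const t _ _, fun v => by simp⟩⟩⟩
  | succ l ih =>
    obtain ⟨Λ₁, hΛ₁⟩ := ih (U := fun t => (U t).submatrix (Fin.castAdd 1) (Fin.castAdd 1))
      (fun i j => hU _ _) (fun t ht i j hij => htri t ht (Fin.lt_def.2 hij))
      (fun i => hcont _) (fun i => hneg _)
    obtain ⟨a, ha⟩ := isBigO_principal.1 (hU (Fin.last l) (Fin.last l))
    obtain ⟨Λ₂, hΛ₂⟩ := exists_isLyapunovMatrix_smul_one_of_upperBohl_neg (ι := Fin 1)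
      (fun t ht => by simpa using ha t ht) hD (hcont _) (hneg (Fin.last l))
    obtain ⟨γ, hγ⟩ := hΛ₁.exists_fromBlocks hΛ₂
      (F := fun t => (U t).submatrix (Fin.castAdd 1) (Fin.natAdd l)) fun i j => hU _ _
    refine IsLyapunovMatrix.exists_of_submatrix finSumFinEquiv (hγ.congr fun t ht => ?_)
    rw [submatrix_finSumFinEquiv_eq_fromBlocks fun i j => htri t ht (castAdd_lt_natAdd j i)]
    congr 1
    ext i j
    rw [Subsingleton.elim i 0, Subsingleton.elim j 0]
    simp [Fin.last, Fin.natAdd]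

/-! ### The continuous QR decomposition -/

lemma skewOfLower_transpose {k : ℕ} (M : Mat k k) : (skewOfLower M)ᵀ = -skewOfLower M := by
  ext i j
  simp only [skewOfLower, Matrix.transpose_apply, Matrix.of_apply, Matrix.neg_apply]
  rcases lt_trichotomy i j with h | rfl | h
  · simp only [h, h.not_gt, if_true, if_false, neg_neg]
  · simp only [lt_irrefl, if_false, neg_zero]
  · simp only [h, h.not_gt, if_true, if_false]

lemma qrSkew_transpose {n k : ℕ} (A : Mat n n) (Q : Mat n k) : (qrSkew A Q)ᵀ = -qrSkew A Q :=
  skewOfLower_transpose _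

lemma qrB_blockTriangular {n k : ℕ} (A : Mat n n) (Q : Mat n k) :
    (qrB A Q).BlockTriangular id := fun i j hij => by
  simp [qrB, qrSkew, skewOfLower, show j < i from hij]

lemma qrB_apply_self {n k : ℕ} (A : Mat n n) (Q : Mat n k) (i : Fin k) :
    qrB A Q i i = (Qᵀ * A * Q) i i := by
  simp [qrB, qrSkew, skewOfLower]

lemma BoundedEntries.qrB {n k : ℕ} {A : ℝ → Mat n n} {Q : ℝ → Mat n k} (hA : BoundedEntries A)
    (hQ : BoundedEntries Q) : BoundedEntries fun t => qrB (A t) (Q t) := by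
  have hQAQ : BoundedEntries fun t => (Q t)ᵀ * A t * Q t := (hQ.transpose.mul hA).mul hQ
  refine hQAQ.sub fun i j => ?_
  rcases lt_trichotomy i j with h | rfl | h
  · simpa only [qrSkew, skewOfLower, Matrix.of_apply, h, h.not_gt, if_true, if_false] using
      (hQAQ j i).neg_left
  · simpa only [qrSkew, skewOfLower, Matrix.of_apply, lt_irrefl, if_false] using isBigO_zero _ _
  · simpa only [qrSkew, skewOfLower, Matrix.of_apply, h, if_true] using hQAQ i j

lemma qrB_submatrix_id {n k l : ℕ} (A : Mat n n) (Q : Mat n l) {e : Fin k → Fin l}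
    (he : StrictMono e) : qrB A (Q.submatrix id e) = (qrB A Q).submatrix e e := by
  have hconj : (Q.submatrix id e)ᵀ * A * Q.submatrix id e = (Qᵀ * A * Q).submatrix e e := rfl
  ext i j
  simp only [qrB, qrSkew, skewOfLower, hconj, Matrix.sub_apply, Matrix.of_apply,
    Matrix.submatrix_apply, he.lt_iff_lt]

section FullQR

variable {n : ℕ} {A Q : ℝ → Mat n n}

lemma IsFullQR.transpose_mul_self (h : IsFullQR A Q) {t : ℝ} (ht : 0 ≤ t) :
    (Q t)ᵀ * Q t = 1 := by
  obtain ⟨hcont, D, hD, hder⟩ := h.ode.solvesOn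
  have hcont' : ContinuousOn (fun s => Q s * (Q s)ᵀ) (Icc 0 t) := by
    have hQ : ContinuousOn Q (Icc 0 t) := hcont.mono Icc_subset_Ici_self
    fun_prop
  have hder' : ∀ s ∈ Ioo 0 t \ (D ∩ Ici 0), HasDerivAt (fun s => Q s * (Q s)ᵀ) 0 s := by
    rintro s ⟨hs, hsD⟩
    have hQ := hder s hs.1.le fun h => hsD ⟨h, hs.1.le⟩
    have hQQ := hasDerivWithinAt_matrix_mul hQ (hasDerivWithinAt_transpose hQ)
    have hzero : Q s * qrSkew (A s) (Q s) * (Q s)ᵀ + Q s * (Q s * qrSkew (A s) (Q s))ᵀ = 0 := by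
      rw [Matrix.transpose_mul, qrSkew_transpose, Matrix.neg_mul, Matrix.mul_neg, Matrix.mul_assoc,
        add_neg_cancel]
    exact (hzero ▸ hQQ).hasDerivAt (Ici_mem_nhds hs.1)
  have hconst := integral_eq_of_hasDerivAt_off_countable_of_le _ (fun _ => 0) ht
    hD.countable_inter_Ici hcont' hder' intervalIntegrable_const
  rw [intervalIntegral.integral_zero, eq_comm, sub_eq_zero, mul_eq_one_comm.1 h.init] at hconst
  exact mul_eq_one_comm.1 hconst

lemma upperBohl_neg_of_jStar_le {k : ℕ} (h : jStar A Q ≤ k) {i : Fin n} (hi : k ≤ (i : ℕ)) :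
    upperBohl (fun t => ((Q t)ᵀ * A t * Q t) i i) < 0 := by
  have hmem : jStar A Q ∈ {j : ℕ | j ≤ n ∧
      ∀ i : Fin n, j ≤ (i : ℕ) → upperBohl (fun t => ((Q t)ᵀ * A t * Q t) i i) < 0} :=
    Nat.sInf_mem ⟨n, le_rfl, fun i hi => absurd hi i.isLt.not_ge⟩
  exact hmem.2 i (h.trans hi)

theorem IsFullQR.exists_isLyapunovMatrix_of_coordinates (hQ : IsFullQR A Q) {N Λ : ℝ → Mat n n}
    (hΛ : IsLyapunovMatrix (fun t => (Q t)ᵀ * N t * Q t - qrSkew (A t) (Q t)) Λ) :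
    ∃ Λ', IsLyapunovMatrix N Λ' := by
  have horth : ∀ t, 0 ≤ t → Q t * (Q t)ᵀ = 1 := fun t ht =>
    mul_eq_one_comm.1 (hQ.transpose_mul_self ht)
  obtain ⟨hcont, D, hD, hder⟩ := hQ.ode.solvesOn
  refine ⟨_, hΛ.pullback (W := fun t => (Q t)ᵀ) (fun t ht => ?_)
    ⟨continuous_id.matrix_transpose.comp_continuousOn hcont, D, hD, fun t ht htD => ?_⟩⟩
  · rw [Matrix.transpose_transpose, horth t ht]
  · have hflow : (Q t * qrSkew (A t) (Q t))ᵀ =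
        ((Q t)ᵀ * N t * Q t - qrSkew (A t) (Q t)) * (Q t)ᵀ - (Q t)ᵀ * N t := by
      rw [Matrix.sub_mul, Matrix.mul_assoc _ (Q t), horth t ht, Matrix.mul_one,
        sub_sub_cancel_left, Matrix.transpose_mul, qrSkew_transpose, Matrix.neg_mul]
    exact (hasDerivWithinAt_transpose (hder t ht htD)).congr_deriv hflow

end FullQR

theorem IsFullQR.exists_isLyapunovMatrix_qrB_submatrix {k l : ℕ} {A Q : ℝ → Mat (k + l) (k + l)}
    (hQ : IsFullQR A Q) (hAb : BoundedEntries A) (hA : PiecewiseContinuous A)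
    (hjk : jStar A Q ≤ k) :
    ∃ Λ, IsLyapunovMatrix
      (fun t => (qrB (A t) (Q t)).submatrix (Fin.natAdd k) (Fin.natAdd k)) Λ := by
  obtain ⟨D, hD, hAc⟩ := hA
  have hQb := BoundedEntries.of_transpose_mul_self_eq_one fun t ht => hQ.transpose_mul_self ht
  refine exists_isLyapunovMatrix_of_blockTriangular (fun i j => (hAb.qrB hQb) _ _)
    (fun t _ i j hij => qrB_blockTriangular _ _ (Nat.add_lt_add_left hij k)) hD
    (fun i t ht htD => ?_) fun i => ?_
  · simp only [Matrix.submatrix_apply, qrB_apply_self]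
    have hQt : ContinuousWithinAt Q (Ici 0) t := hQ.ode.solvesOn.1 t ht
    have hAt := hAc t ht htD
    have hQAQ : ContinuousWithinAt (fun s => (Q s)ᵀ * A s * Q s) (Ici 0) t := by fun_prop
    exact continuousWithinAt_pi.1 (continuousWithinAt_pi.1 hQAQ _) _
  · simp only [Matrix.submatrix_apply, qrB_apply_self]
    exact upperBohl_neg_of_jStar_le hjk (by simp)

/-! ### The error dynamics -/

section ClosedLoop

variable {k l p : ℕ} {A Q : Mat (k + l) (k + l)} {Qbar : Mat (k + l) k}

lemma one_submatrix_castAdd_mul_apply_castAdd (N : Mat k p) (i : Fin k) (j : Fin p) :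
    ((1 : Mat (k + l) (k + l)).submatrix id (Fin.castAdd l) * N) (Fin.castAdd l i) j = N i j := by
  have hrows : (1 : Mat (k + l) (k + l)).submatrix (Fin.castAdd l) (Fin.castAdd l) * N = N := by
    rw [Matrix.submatrix_one _ (Fin.castAdd_injective k l), Matrix.one_mul]
  exact congr_fun₂ hrows i j

lemma one_submatrix_castAdd_mul_apply_natAdd (N : Mat k p) (i : Fin l) (j : Fin p) :
    ((1 : Mat (k + l) (k + l)).submatrix id (Fin.castAdd l) * N) (Fin.natAdd k i) j = 0 := by
  rw [Matrix.mul_apply]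
  refine Finset.sum_eq_zero fun r _ => mul_eq_zero_of_left ?_ _
  exact Matrix.one_apply_ne (castAdd_lt_natAdd r i).ne'

lemma transpose_mul_observerGain_mul_submatrix (hQ : Qᵀ * Q = 1)
    (hQbar : Qbar = Q.submatrix id (Fin.castAdd l)) (C : Mat p (k + l)) (P : Mat k k) :
    (Qᵀ * (observerGain C Qbar P * C) * Q).submatrix finSumFinEquiv finSumFinEquiv =
      Matrix.fromBlocks (P * (C * Qbar)ᵀ * (C * Qbar))
        (P * (C * Qbar)ᵀ * (C * Q.submatrix id (Fin.natAdd k))) 0 0 := by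
  have hproj : Qᵀ * Qbar = (1 : Mat (k + l) (k + l)).submatrix id (Fin.castAdd l) := by
    rw [hQbar, ← hQ]
    rfl
  have hgain : Qᵀ * (observerGain C Qbar P * C) * Q =
      (1 : Mat (k + l) (k + l)).submatrix id (Fin.castAdd l) * (P * (C * Qbar)ᵀ * (C * Q)) := by
    simp only [← hproj, observerGain, Matrix.mul_assoc]
  rw [hgain]
  subst hQbar
  ext (i | i) (j | j)
  exacts [one_submatrix_castAdd_mul_apply_castAdd _ i _,
    one_submatrix_castAdd_mul_apply_castAdd _ i _, one_submatrix_castAdd_mul_apply_natAdd _ i _,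
    one_submatrix_castAdd_mul_apply_natAdd _ i _]

theorem closedLoop_submatrix_eq_fromBlocks (hQ : Qᵀ * Q = 1)
    (hQbar : Qbar = Q.submatrix id (Fin.castAdd l)) (C : Mat p (k + l)) (P : Mat k k) :
    (Qᵀ * (A - observerGain C Qbar P * C) * Q - qrSkew A Q).submatrix
        finSumFinEquiv finSumFinEquiv =
      Matrix.fromBlocks (qrB A Qbar - P * (C * Qbar)ᵀ * (C * Qbar))
        ((qrB A Q).submatrix (Fin.castAdd l) (Fin.natAdd k) -
          P * (C * Qbar)ᵀ * (C * Q.submatrix id (Fin.natAdd k))) 0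
        ((qrB A Q).submatrix (Fin.natAdd k) (Fin.natAdd k)) := by
  have hsplit : Qᵀ * (A - observerGain C Qbar P * C) * Q - qrSkew A Q =
      qrB A Q - Qᵀ * (observerGain C Qbar P * C) * Q := by
    rw [Matrix.mul_sub, Matrix.sub_mul, sub_right_comm, qrB]
  rw [hsplit, Matrix.submatrix_sub, Pi.sub_apply, Pi.sub_apply,
    transpose_mul_observerGain_mul_submatrix hQ hQbar, submatrix_finSumFinEquiv_eq_fromBlocks
      fun i j => qrB_blockTriangular A Q (castAdd_lt_natAdd j i), ← qrB_submatrix_id A Q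
      (Fin.strictMono_castAdd l), ← hQbar, sub_eq_add_neg, Matrix.fromBlocks_neg,
    Matrix.fromBlocks_add]
  simp only [neg_zero, add_zero, sub_eq_add_neg]

end ClosedLoop

lemma matVec_mul {n m p : ℕ} (M : Mat n m) (N : Mat m p) (v : Vec p) :
    matVec (M * N) v = matVec M (matVec N v) := by
  simp only [matVec, Matrix.toLpLin_apply, Matrix.mulVec_mulVec]

lemma matVec_sub_left {n m : ℕ} (M N : Mat n m) (v : Vec m) :
    matVec (M - N) v = matVec M v - matVec N v := by
  simp only [matVec, map_sub, LinearMap.sub_apply]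

lemma SolvesOn.sub {E : Type} [NormedAddCommGroup E] [NormedSpace ℝ E] {I : Set ℝ}
    {x₁ x₂ v₁ v₂ : ℝ → E} (h₁ : SolvesOn I x₁ v₁) (h₂ : SolvesOn I x₂ v₂) :
    SolvesOn I (fun t => x₁ t - x₂ t) (fun t => v₁ t - v₂ t) := by
  obtain ⟨hcont₁, D₁, hD₁, hder₁⟩ := h₁
  obtain ⟨hcont₂, D₂, hD₂, hder₂⟩ := h₂
  exact ⟨hcont₁.sub hcont₂, D₁ ∪ D₂, hD₁.union hD₂, fun t ht htD =>
    (hder₁ t ht fun h => htD (Or.inl h)).sub (hder₂ t ht fun h => htD (Or.inr h))⟩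

lemma errorField_sub {n m p k : ℕ} (f : Vec n → Vec m → Vec n) (C : ℝ → Mat p n)
    (u : ℝ → Vec m) (xhat : ℝ → Vec n) (Qbar : ℝ → Mat n k) (P₁ : ℝ → Mat k k) (t : ℝ)
    (x : Vec n) :
    errorField f C u xhat Qbar P₁ t (x - xhat t) =
      f x (u t) - (f (xhat t) (u t) + matVec (observerGain (C t) (Qbar t) (P₁ t))
        (matVec (C t) x - matVec (C t) (xhat t))) := by
  rw [errorField, taylorRemainder, matVec_sub_left, matVec_mul, add_sub_cancel, jacobianAlong,
    ← map_sub (Matrix.toEuclideanLin (C t))]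
  abel

theorem IsExtendedSubspaceObserver.exists_isLyapunovMatrix {m p k l : ℕ}
    {f : Vec (k + l) → Vec m → Vec (k + l)} {C : ℝ → Mat p (k + l)} (hC : BoundedEntries C)
    {u : ℝ → Vec m} {y : ℝ → Vec p} {G₁ : ℝ → Mat k k} {xhat : ℝ → Vec (k + l)}
    {Qbar : ℝ → Mat (k + l) k} {P₁ : ℝ → Mat k k}
    (hobs : IsExtendedSubspaceObserver f C u y G₁ xhat Qbar P₁)
    (hAb : BoundedEntries (jacobianAlong f xhat u))
    (hA : PiecewiseContinuous (jacobianAlong f xhat u))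
    {Q : ℝ → Mat (k + l) (k + l)} (hQ : IsFullQR (jacobianAlong f xhat u) Q)
    (hQbar : ∀ t, 0 ≤ t → Qbar t = (Q t).submatrix id (Fin.castAdd l))
    (hjk : jStar (jacobianAlong f xhat u) Q ≤ k) {p₁ p₂ : ℝ} (hp₁ : 0 < p₁) (hp₂ : 0 < p₂)
    (hP : ∀ t, 0 ≤ t → LoewnerLE (p₁ • 1) (P₁ t) ∧ LoewnerLE (P₁ t) (p₂ • 1)) :
    ∃ Λ, IsLyapunovMatrix
      (fun t => jacobianAlong f xhat u t - observerGain (C t) (Qbar t) (P₁ t) * C t) Λ := by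
  obtain ⟨g, _, hg, -, hG⟩ := hobs.weight
  have horth : ∀ t, 0 ≤ t → (Q t)ᵀ * Q t = 1 := fun t ht => hQ.transpose_mul_self ht
  have hQb := BoundedEntries.of_transpose_mul_self_eq_one horth
  have hCQbar : BoundedEntries fun t => C t * Qbar t := by
    refine hC.mul (.of_transpose_mul_self_eq_one fun t ht => ?_)
    rw [hQbar t ht]
    exact (congrArg (Matrix.submatrix · (Fin.castAdd l) (Fin.castAdd l)) (horth t ht)).trans
      (Matrix.submatrix_one _ (Fin.castAdd_injective k l))
  have hPb : BoundedEntries P₁ := .of_loewnerLE hp₂ fun t ht =>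
    ⟨((hP t ht).1.posDef hp₁).posSemidef, (hP t ht).2⟩
  have hcoupling : BoundedEntries fun t =>
      (qrB (jacobianAlong f xhat u t) (Q t)).submatrix (Fin.castAdd l) (Fin.natAdd k) -
        P₁ t * (C t * Qbar t)ᵀ * (C t * (Q t).submatrix id (Fin.natAdd k)) :=
    .sub (fun i j => hAb.qrB hQb _ _)
      ((hPb.mul hCQbar.transpose).mul (hC.mul fun i j => hQb _ _))
  have hunstable := isLyapunovMatrix_riccati_inv hp₁ hp₂ hg hP (fun t ht => (hG t ht).1)
    hobs.riccati.solvesOn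
  obtain ⟨Λ₂, hstable⟩ := hQ.exists_isLyapunovMatrix_qrB_submatrix hAb hA hjk
  obtain ⟨γ, hγ⟩ := hunstable.exists_fromBlocks hstable hcoupling
  obtain ⟨Λ, hΛ⟩ := IsLyapunovMatrix.exists_of_submatrix finSumFinEquiv (hγ.congr fun t ht =>
    (closedLoop_submatrix_eq_fromBlocks (horth t ht) (hQbar t ht) (C t) (P₁ t)).symm)
  exact hQ.exists_isLyapunovMatrix_of_coordinates hΛ

theorem mainTheorem2 {n m p k : ℕ} (hkn : k ≤ n)
    -- the plant and its output matrix
    (f : Vec n → Vec m → Vec n) (hf : ∀ v : Vec m, Differentiable ℝ (fun z => f z v))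
    (C : ℝ → Mat p n) (hC : ∃ c : ℝ, ∀ t : ℝ, 0 ≤ t → ‖C t‖ ≤ c)
    (u : ℝ → Vec m) (x : ℝ → Vec n) (hx : IsPlantTrajectory f u x)
    -- the observer, driven by the output `y = C x`
    (G₁ : ℝ → Mat k k) (xhat : ℝ → Vec n) (Qbar : ℝ → Mat n k) (P₁ : ℝ → Mat k k)
    (hobs : IsExtendedSubspaceObserver f C u (fun t => matVec (C t) (x t)) G₁ xhat Qbar P₁)
    (hA : PiecewiseContinuous (jacobianAlong f xhat u))
    -- the choice `j* ≤ k` of the number of columns of `Q̄`, where `Q = [Q̄  Q̄⊥]`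
    (Q : ℝ → Mat n n) (hQ : IsFullQR (jacobianAlong f xhat u) Q)
    (hpart : ∀ t : ℝ, 0 ≤ t → ∀ (i : Fin n) (j : Fin k), Qbar t i j = Q t i (Fin.castLE hkn j))
    (hjk : jStar (jacobianAlong f xhat u) Q ≤ k)
    -- (a1) the Jacobian along the estimate is bounded
    (a1 : ∃ a : ℝ, ∀ t : ℝ, 0 ≤ t → ‖jacobianAlong f xhat u t‖ ≤ a)
    -- (a2) `P₁` is bounded above and below
    (a2 : ∃ p₁ p₂ : ℝ, 0 < p₁ ∧ 0 < p₂ ∧ ∀ t : ℝ, 0 ≤ t →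
      LoewnerLE (p₁ • (1 : Mat k k)) (P₁ t) ∧ LoewnerLE (P₁ t) (p₂ • (1 : Mat k k)))
    -- (a3) the Taylor remainder is bounded quadratically
    (a3 : ∃ ε κ : ℝ, 0 < ε ∧ 0 < κ ∧ ∀ (e z : Vec n) (v : Vec m), ‖e‖ ≤ ε →
      ‖taylorRemainder f e z v‖ ≤ κ * ‖e‖ ^ 2) :
    -- the estimation error obeys the error dynamics, which is stable
    SolvesOn (Set.Ici 0) (fun t => x t - xhat t)
      (fun t => errorField f C u xhat Qbar P₁ t (x t - xhat t)) ∧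
    LocallyUniformlyExpStable (errorField f C u xhat Qbar P₁) := by
  refine ⟨?_, ?_⟩
  · have herror := hx.sub hobs.estimate
    simpa only [errorField_sub] using herror
  · obtain ⟨l, rfl⟩ := Nat.exists_eq_add_of_le hkn
    obtain ⟨c, hC⟩ := hC
    obtain ⟨a, hAa⟩ := a1
    obtain ⟨p₁, p₂, hp₁, hp₂, hP⟩ := a2
    obtain ⟨ε, κ, hε, -, hη⟩ := a3
    obtain ⟨Λ, hΛ⟩ := hobs.exists_isLyapunovMatrix (.of_norm_le hC) (.of_norm_le hAa) hA hQ
      (fun t ht => Matrix.ext fun i j => hpart t ht i j) hjk hp₁ hp₂ hP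
    exact hΛ.locallyUniformlyExpStable (η := fun t e => taylorRemainder f e (xhat t) (u t))
      ⟨ε, κ, hε, fun t _ e he => hη e (xhat t) (u t) he⟩
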